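/- **Setting.** Let $p\in(0,1)$, $\beta\in\mathbb R$, $n\ge 1$ and $k\in\{0,\dots,3^n-1\}$. *Laplacian.* For an integer $x\ge 1$ let $3^{m(x)}$ be the largest power of $3$ dividing $x$. Put $p(0,1)=1$ and, for $x\ge1$, $p(x,x+1)=p$, $p(x,x-1)=1-p$ if $3^{-m(x)}x\equiv 1\pmod 3$, and $p(x,x+1)=1-p$, $p(x,x-1)=p$ if $3^{-m(x)}x\equiv 2\pmod 3$. The self-similar Laplacian is $(\Delta_pf)(0)=f(0)-f(1)$, $(\Delta_pf)(x)=f(x)-p(x,x-1)f(x-1)-p(x,x+1)f(x+1)$ for $x\ge1$, a bounded self-adjoint operator on $\ell^2(\mathbb Z_+,d\pi)$, where $\pi(0)=1$ and $\pi(x)p(x,x+1)=\pi(x+1)p(x+1,x)$; $\sigma(\Delta_p)$ is its spectrum. *Spectral decimation polynomial.* Let $H^{(n)}$ be the matrix indexed by $\{0,\dots,3^n\}$ with diagonal entries $\beta\cos(2\pi kx/3^n)$ and off-diagonal entries $-p(x,x\pm1)$ for $0<x<3^n$, $H^{(n)}_{0,1}=H^{(n)}_{3^n,3^n-1}=-1$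 (the truncation to $\{0,\dots,3^n\}$, with reflection at both ends, of the self-similar almost Mathieu operator $H_{p,\beta,k/3^n,0}$, which is obtained from $\Delta_p$ by replacing its diagonal with $\beta\cos(2\pi kx/3^n)$). The Schur complement of $H^{(n)}-z$ onto the boundary vertices $\{0,3^n\}$ has the form $\varphi(z)\begin{pmatrix}1&-1\\-1&1\end{pmatrix}-\psi(z)I$ with rational functions $\varphi\ne0$ and $\psi$, and $R:=\psi/\varphi$ is a polynomial of degree $3^n$. *Inverse branches.* There are continuous functions $S_1,\dots,S_{3^n}:[0,2]\to\mathbb R$ such that, for every $x\in[0,2]$, $S_1(x),\dots,S_{3^n}(x)$ are all the complex solutions $z$ of $R(z)=x$, listed with multiplicity; any such functions are called the branches of $R^{-1}$. *Measures.* Let $R_{\Delta_p}(z)=\frac{z(z+p-2)(z-p-1)}{p(1-p)}$. There exists a balanced invariant measure $\nu_p$ of the Julia set of $R_{\Delta_p}$, i.e. a Borel probability measure on $\mathbb R$ that is carried by the Julia set of $R_{\Delta_p}$, is invariant under $R_{\Delta_p}$, and satisfies $\nu_p(R_{\Delta_p}(A))=3\,\nu_p(A)$ for every Borel set $A\subset\mathbb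 R$ on which $R_{\Delta_p}$ is injective. The density of states of $H_{p,\beta,k/3^n,0}$ is the measure $$\nu_{p,\beta,k/3^n,0}(B)=\frac1{3^n}\sum_{i=1}^{3^n}\int_{\sigma(\Delta_p)}\chi_B(S_i(x))\,\nu_p(dx).$$ **Statement.** $R$, the branches $S_1,\dots,S_{3^n}$ and $\nu_p$ exist as described, and for every $j\in\{1,\dots,3^n\}$ and every $E\subset\sigma(\Delta_p)$, $$\nu_{p,\beta,k/3^n,0}(S_j(E))=\frac1{3^n}\,\nu_p(E).$$ (For non-measurable $E$ the measures are read as outer measures.) -/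

import Mathlib

open MeasureTheory Polynomial

noncomputable section

namespace SelfSimilarAMO

/-! ### The self-similar Laplacian on the half-line -/

/-- `stepRight p x` is the transition probability `p(x, x+1)`: it is `1` at the reflecting origin,
and for `x ≥ 1`, with `3^m` the largest power of `3` dividing `x`, it is `p` if
`x / 3^m ≡ 1 (mod 3)` and `1 - p` if `x / 3^m ≡ 2 (mod 3)`. -/
def stepRight (p : ℝ) (x : ℕ) : ℝ :=
  if x = 0 then 1 else if (x / 3 ^ padicValNat 3 x) % 3 = 1 then p else 1 - p

/-- `stepLeft p x` is the transition probability `p(x, x-1)` for `x ≥ 1` (and `0` at `x = 0`). -/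
def stepLeft (p : ℝ) (x : ℕ) : ℝ :=
  if x = 0 then 0 else if (x / 3 ^ padicValNat 3 x) % 3 = 1 then 1 - p else p

/-- The self-similar Laplacian `Δ_p` acting on arbitrary complex sequences. -/
def lapFun (p : ℝ) (f : ℕ → ℂ) : ℕ → ℂ
  | 0 => f 0 - f 1
  | x + 1 => f (x + 1) - stepLeft p (x + 1) * f x - stepRight p (x + 1) * f (x + 2)

/-- The reversing weights `π` of the walk, `π(x) p(x, x+1) = π(x+1) p(x+1, x)`, normalized by
`π(0) = 1`. -/
def revWeight (p : ℝ) : ℕ → ℝ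
  | 0 => 1
  | x + 1 => revWeight p x * stepRight p x / stepLeft p (x + 1)

/-- The reversing measure `π` on the half-line. -/
def revMeasure (p : ℝ) : Measure ℕ :=
  Measure.count.withDensity fun x => ENNReal.ofReal (revWeight p x)

/-- The Hilbert space `ℓ²(ℤ₊, dπ)`. -/
abbrev Ell2 (p : ℝ) : Type := Lp ℂ 2 (revMeasure p)

theorem stepRight_pos {p : ℝ} (hp : p ∈ Set.Ioo (0 : ℝ) 1) (x : ℕ) : 0 < stepRight p x := by
  have h0 := hp.1
  have h1 := hp.2
  unfold stepRight
  split_ifs <;> linarith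

theorem stepLeft_succ_pos {p : ℝ} (hp : p ∈ Set.Ioo (0 : ℝ) 1) (x : ℕ) :
    0 < stepLeft p (x + 1) := by
  have h0 := hp.1
  have h1 := hp.2
  unfold stepLeft
  rw [if_neg (Nat.succ_ne_zero x)]
  split_ifs <;> linarith

theorem stepLeft_nonneg {p : ℝ} (hp : p ∈ Set.Ioo (0 : ℝ) 1) (x : ℕ) : 0 ≤ stepLeft p x := by
  cases x with
  | zero => simp [stepLeft]
  | succ x => exact (stepLeft_succ_pos hp x).le

theorem stepLeft_add_stepRight (p : ℝ) (x : ℕ) : stepLeft p x + stepRight p x = 1 := by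
  unfold stepLeft stepRight
  split_ifs <;> ring

theorem revWeight_pos {p : ℝ} (hp : p ∈ Set.Ioo (0 : ℝ) 1) (x : ℕ) : 0 < revWeight p x := by
  induction x with
  | zero => simp [revWeight]
  | succ x ih =>
    exact div_pos (mul_pos ih (stepRight_pos hp x)) (stepLeft_succ_pos hp x)

/-- Reversibility of the weights. -/
theorem revWeight_reversible {p : ℝ} (hp : p ∈ Set.Ioo (0 : ℝ) 1) (x : ℕ) :
    revWeight p (x + 1) * stepLeft p (x + 1) = revWeight p x * stepRight p x := by
  have h := (stepLeft_succ_pos hp x).ne'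
  simp only [revWeight]
  field_simp

theorem lintegral_revMeasure (p : ℝ) (g : ℕ → ENNReal) :
    ∫⁻ x, g x ∂(revMeasure p) = ∑' x, ENNReal.ofReal (revWeight p x) * g x := by
  unfold revMeasure
  rw [lintegral_withDensity_eq_lintegral_mul _ (measurable_of_countable _)
    (measurable_of_countable _), lintegral_count]
  rfl

theorem ae_revMeasure_iff {p : ℝ} (hp : p ∈ Set.Ioo (0 : ℝ) 1) {P : ℕ → Prop} :
    (∀ᵐ x ∂(revMeasure p), P x) ↔ ∀ x, P x := by
  unfold revMeasure
  rw [ae_withDensity_iff (measurable_of_countable _)]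
  have hpos : ∀ x, ENNReal.ofReal (revWeight p x) ≠ 0 := fun x => by
    simpa using revWeight_pos hp x
  simp [hpos, ae_iff, Measure.count_eq_zero_iff, Set.eq_empty_iff_forall_notMem]

theorem enorm_sub_lapFun_sq_le {p : ℝ} (hp : p ∈ Set.Ioo (0 : ℝ) 1) (f : ℕ → ℂ) (x : ℕ) :
    ‖(f - lapFun p f) (x + 1)‖ₑ ^ 2 ≤
      ENNReal.ofReal (stepLeft p (x + 1)) * ‖f x‖ₑ ^ 2 +
        ENNReal.ofReal (stepRight p (x + 1)) * ‖f (x + 2)‖ₑ ^ 2 := by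
  have hl := stepLeft_nonneg hp (x + 1)
  have hr := (stepRight_pos hp (x + 1)).le
  have hs := stepLeft_add_stepRight p (x + 1)
  have e : (f - lapFun p f) (x + 1) =
      stepLeft p (x + 1) * f x + stepRight p (x + 1) * f (x + 2) := by
    simp only [Pi.sub_apply, lapFun]
    ring
  have h1 : ‖(f - lapFun p f) (x + 1)‖ ≤
      stepLeft p (x + 1) * ‖f x‖ + stepRight p (x + 1) * ‖f (x + 2)‖ := by
    rw [e]
    refine (norm_add_le _ _).trans_eq ?_
    rw [norm_mul, norm_mul, Complex.norm_of_nonneg hl, Complex.norm_of_nonneg hr]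
  have h2 : ‖(f - lapFun p f) (x + 1)‖ ^ 2 ≤
      stepLeft p (x + 1) * ‖f x‖ ^ 2 + stepRight p (x + 1) * ‖f (x + 2)‖ ^ 2 := by
    refine (pow_le_pow_left₀ (norm_nonneg _) h1 2).trans ?_
    have hs' : stepRight p (x + 1) = 1 - stepLeft p (x + 1) := by linarith
    rw [hs'] at hr ⊢
    nlinarith [mul_nonneg (mul_nonneg hl hr) (sq_nonneg (‖f x‖ - ‖f (x + 2)‖))]
  simp only [← ofReal_norm, ← ENNReal.ofReal_pow (norm_nonneg _)]
  rw [← ENNReal.ofReal_mul hl, ← ENNReal.ofReal_mul hr,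
    ← ENNReal.ofReal_add (by positivity) (by positivity)]
  exact ENNReal.ofReal_le_ofReal h2

/-- The averaging operator `1 - Δ_p` does not increase the `ℓ²(dπ)` norm. -/
theorem eLpNorm_sub_lapFun_le {p : ℝ} (hp : p ∈ Set.Ioo (0 : ℝ) 1) (f : ℕ → ℂ) :
    eLpNorm (f - lapFun p f) 2 (revMeasure p) ≤ eLpNorm f 2 (revMeasure p) := by
  have key : ∫⁻ x, ‖(f - lapFun p f) x‖ₑ ^ 2 ∂(revMeasure p) ≤
      ∫⁻ x, ‖f x‖ₑ ^ 2 ∂(revMeasure p) := by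
    rw [lintegral_revMeasure, lintegral_revMeasure]
    set w : ℕ → ENNReal := fun x => ENNReal.ofReal (revWeight p x)
    set a : ℕ → ENNReal := fun x => ENNReal.ofReal (stepLeft p x)
    set b : ℕ → ENNReal := fun x => ENNReal.ofReal (stepRight p x)
    have hrev : ∀ x, w (x + 1) * a (x + 1) = w x * b x := fun x => by
      simp only [w, a, b]
      rw [← ENNReal.ofReal_mul (revWeight_pos hp _).le,
        ← ENNReal.ofReal_mul (revWeight_pos hp _).le, revWeight_reversible hp]
    have hsum : ∀ x, a x + b x = 1 := fun x => by
      simp only [a, b]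
      rw [← ENNReal.ofReal_add (stepLeft_nonneg hp x) (stepRight_pos hp x).le,
        stepLeft_add_stepRight, ENNReal.ofReal_one]
    have ha0 : a 0 = 0 := by simp [a, stepLeft]
    have hb0 : b 0 = 1 := by simp [b, stepRight]
    calc ∑' x, w x * ‖(f - lapFun p f) x‖ₑ ^ 2
        = w 0 * ‖(f - lapFun p f) 0‖ₑ ^ 2 +
            ∑' x, w (x + 1) * ‖(f - lapFun p f) (x + 1)‖ₑ ^ 2 :=
          tsum_eq_zero_add' ENNReal.summable
      _ ≤ w 0 * b 0 * ‖f 1‖ₑ ^ 2 +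
            ∑' x, (w x * b x * ‖f x‖ₑ ^ 2 + w (x + 2) * a (x + 2) * ‖f (x + 2)‖ₑ ^ 2) := by
          refine add_le_add (le_of_eq ?_) (ENNReal.tsum_le_tsum fun x => ?_)
          · rw [hb0, mul_one]
            simp [lapFun]
          · refine (mul_le_mul_right (enorm_sub_lapFun_sq_le hp f x) _).trans_eq ?_
            rw [mul_add, ← mul_assoc, ← mul_assoc, ← hrev x, hrev (x + 1)]
      _ = (∑' x, w (x + 1) * a (x + 1) * ‖f (x + 1)‖ₑ ^ 2) +
            ∑' x, w x * b x * ‖f x‖ₑ ^ 2 := by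
          rw [ENNReal.tsum_add, ← hrev 0,
            tsum_eq_zero_add' (f := fun x => w (x + 1) * a (x + 1) * ‖f (x + 1)‖ₑ ^ 2)
              ENNReal.summable]
          ring
      _ = (∑' x, w x * a x * ‖f x‖ₑ ^ 2) + ∑' x, w x * b x * ‖f x‖ₑ ^ 2 := by
          rw [tsum_eq_zero_add' (f := fun x => w x * a x * ‖f x‖ₑ ^ 2) ENNReal.summable, ha0]
          simp
      _ = ∑' x, w x * ‖f x‖ₑ ^ 2 := by
          rw [← ENNReal.tsum_add]
          refine tsum_congr fun x => ?_
          rw [← add_mul, ← mul_add, hsum, mul_one]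
  rw [eLpNorm_eq_lintegral_rpow_enorm_toReal (by norm_num) (by norm_num),
    eLpNorm_eq_lintegral_rpow_enorm_toReal (by norm_num) (by norm_num)]
  have h2 : (2 : ENNReal).toReal = ((2 : ℕ) : ℝ) := by norm_num
  rw [h2]
  simp only [ENNReal.rpow_natCast]
  exact ENNReal.rpow_le_rpow key (by positivity)

theorem memLp_lapFun {p : ℝ} (hp : p ∈ Set.Ioo (0 : ℝ) 1) {f : ℕ → ℂ}
    (hf : MemLp f 2 (revMeasure p)) : MemLp (lapFun p f) 2 (revMeasure p) := by
  have h : MemLp (f - lapFun p f) 2 (revMeasure p) :=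
    ⟨(measurable_of_countable _).aestronglyMeasurable,
      (eLpNorm_sub_lapFun_le hp f).trans_lt hf.2⟩
  have h2 := hf.sub h
  rwa [sub_sub_cancel] at h2

theorem eLpNorm_lapFun_le {p : ℝ} (hp : p ∈ Set.Ioo (0 : ℝ) 1) (f : ℕ → ℂ) :
    eLpNorm (lapFun p f) 2 (revMeasure p) ≤ 2 * eLpNorm f 2 (revMeasure p) := by
  have h : lapFun p f = f - (f - lapFun p f) := by rw [sub_sub_cancel]
  rw [h]
  refine (eLpNorm_sub_le (measurable_of_countable _).aestronglyMeasurable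
    (measurable_of_countable _).aestronglyMeasurable (by norm_num)).trans ?_
  rw [two_mul]
  gcongr
  exact eLpNorm_sub_lapFun_le hp f

/-- The self-similar Laplacian `Δ_p` as a bounded operator on `ℓ²(ℤ₊, dπ)`. -/
def laplacian (p : ℝ) (hp : p ∈ Set.Ioo (0 : ℝ) 1) : Ell2 p →L[ℂ] Ell2 p :=
  LinearMap.mkContinuous
    { toFun := fun f => (memLp_lapFun hp (Lp.memLp f)).toLp (lapFun p f)
      map_add' := fun f g => by
        have h := (ae_revMeasure_iff hp).1 (Lp.coeFn_add f g)
        rw [← MemLp.toLp_add]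
        apply MemLp.toLp_congr
        refine (ae_revMeasure_iff hp).2 fun x => ?_
        cases x <;> simp only [lapFun, h, Pi.add_apply] <;> ring
      map_smul' := fun c f => by
        have h := (ae_revMeasure_iff hp).1 (Lp.coeFn_smul c f)
        rw [RingHom.id_apply, ← MemLp.toLp_const_smul]
        apply MemLp.toLp_congr
        refine (ae_revMeasure_iff hp).2 fun x => ?_
        cases x <;> simp only [lapFun, h, Pi.smul_apply, smul_eq_mul] <;> ring }
    2 fun f => by
      change ‖(memLp_lapFun hp (Lp.memLp f)).toLp (lapFun p f)‖ ≤ 2 * ‖f‖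
      rw [Lp.norm_toLp, Lp.norm_def, ← ENNReal.toReal_ofNat, ← ENNReal.toReal_mul]
      exact ENNReal.toReal_mono (ENNReal.mul_ne_top (by norm_num) (Lp.eLpNorm_ne_top f))
        (eLpNorm_lapFun_le hp f)

/-- The operator `laplacian` is given pointwise by the formula defining `Δ_p`. -/
theorem laplacian_apply {p : ℝ} (hp : p ∈ Set.Ioo (0 : ℝ) 1) (f : Ell2 p) (x : ℕ) :
    laplacian p hp f x = lapFun p f x :=
  (ae_revMeasure_iff hp).1 (MemLp.coeFn_toLp (memLp_lapFun hp (Lp.memLp f))) x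

/-- The spectrum `σ(Δ_p)`, as a set of real numbers (`Δ_p` is self-adjoint). -/
def lapSpectrum (p : ℝ) (hp : p ∈ Set.Ioo (0 : ℝ) 1) : Set ℝ :=
  {x : ℝ | (x : ℂ) ∈ spectrum ℂ (laplacian p hp)}

/-! ### Truncated almost Mathieu operators and the spectral decimation function -/

/-- The level `l` truncation `H^{(l)}_{p,β,α,θ}` of the self-similar almost Mathieu operator, on
the vertices `0, …, 3^l`, with reflection at both ends. -/
def amoMatrix (p β α θ : ℝ) (l : ℕ) : Matrix (Fin (3 ^ l + 1)) (Fin (3 ^ l + 1)) ℝ :=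
  Matrix.of fun i j =>
    if i = j then β * Real.cos (2 * Real.pi * α * (i : ℕ) + θ)
    else if (j : ℕ) = i + 1 then -stepRight p i
    else if (i : ℕ) = j + 1 then (if (i : ℕ) = 3 ^ l then -1 else -stepLeft p i)
    else 0

/-- The boundary vertices `0` and `3^l`. -/
def bdry (l : ℕ) : Fin 2 → Fin (3 ^ l + 1) := ![0, Fin.last (3 ^ l)]

/-- The interior vertices `1, …, 3^l - 1`. -/
def inner (l : ℕ) (i : Fin (3 ^ l - 1)) : Fin (3 ^ l + 1) :=
  ⟨(i : ℕ) + 1, by have := i.isLt; omega⟩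

/-- The level-zero Laplacian `Δ^{(0)}`. -/
def lapZero : Matrix (Fin 2) (Fin 2) (RatFunc ℝ) := !![1, -1; -1, 1]

/-- `H^{(l)} - z`, with entries in the field of rational functions of `z`. -/
def amoShift (p β α θ : ℝ) (l : ℕ) :
    Matrix (Fin (3 ^ l + 1)) (Fin (3 ^ l + 1)) (RatFunc ℝ) :=
  (amoMatrix p β α θ l).map (algebraMap ℝ (RatFunc ℝ)) -
    (RatFunc.X : RatFunc ℝ) • (1 : Matrix (Fin (3 ^ l + 1)) (Fin (3 ^ l + 1)) (RatFunc ℝ))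

/-- The Schur complement `T - z - Jᵀ (X - z)⁻¹ J` of `H^{(l)} - z` onto the boundary vertices,
where `X` is the interior (Dirichlet) block. -/
def amoSchur (p β α θ : ℝ) (l : ℕ) : Matrix (Fin 2) (Fin 2) (RatFunc ℝ) :=
  (amoShift p β α θ l).submatrix (bdry l) (bdry l) -
    (amoShift p β α θ l).submatrix (bdry l) (inner l) *
      ((amoShift p β α θ l).submatrix (inner l) (inner l))⁻¹ *
        (amoShift p β α θ l).submatrix (inner l) (bdry l)

/-- `R` is the spectral decimation polynomial `R_{p,β,α,0} = ψ / φ` at `α = k / 3^n`: the Schur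
complement of `H^{(n)} - z` is `φ(z) Δ^{(0)} - ψ(z)` with rational functions `φ ≠ 0` and
`ψ = R φ`. -/
def IsSpectralDecimation (p β : ℝ) (n k : ℕ) (R : ℝ[X]) : Prop :=
  ∃ φ ψ : RatFunc ℝ, φ ≠ 0 ∧
    amoSchur p β ((k : ℝ) / 3 ^ n) 0 n = φ • lapZero - ψ • (1 : Matrix (Fin 2) (Fin 2) _) ∧
    algebraMap ℝ[X] (RatFunc ℝ) R = ψ / φ

/-- `S 0, …, S (N-1)` are the branches of the inverse of the polynomial `R` over `[0, 2]`:
continuous real functions on `[0, 2]` whose values at every `x` are all the complex roots of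
`R(z) = x`, each listed as often as its multiplicity. -/
def IsInverseBranches (R : ℝ[X]) {N : ℕ} (S : Fin N → ℝ → ℝ) : Prop :=
  (∀ j, ContinuousOn (S j) (Set.Icc 0 2)) ∧
    ∀ x ∈ Set.Icc (0 : ℝ) 2,
      ((R - C x).map (algebraMap ℝ ℂ)).roots = Finset.univ.val.map fun j => (S j x : ℂ)

/-! ### The balanced invariant measure and the density of states -/

/-- The spectral decimation polynomial `R_{Δ_p}` of the Laplacian. -/
def lapDecimation (p : ℝ) : ℝ[X] :=
  C (1 / (p * (1 - p))) * (X * (X + C (p - 2)) * (X - C (p + 1)))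

/-- The Julia set of a complex polynomial (of degree at least two): the boundary of the set of
points with bounded forward orbit. -/
def juliaSet (P : ℂ[X]) : Set ℂ :=
  frontier {z : ℂ | Bornology.IsBounded (Set.range fun m : ℕ => (fun w => P.eval w)^[m] z)}

/-- `ν` is the balanced invariant measure of the Julia set of the real polynomial `R`, whose
Julia set is contained in the real line: an `R`-invariant probability measure carried by the
Julia set, such that `ν (R(A)) = deg R · ν A` for all Borel sets `A` on which `R` is injective. -/
structure IsBalancedMeasure (R : ℝ[X]) (ν : Measure ℝ) : Prop where
  isProbabilityMeasure : IsProbabilityMeasure ν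
  carried : ∀ᵐ x : ℝ ∂ν, (x : ℂ) ∈ juliaSet (R.map (algebraMap ℝ ℂ))
  invariant : MeasurePreserving (fun x => R.eval x) ν ν
  balanced : ∀ A : Set ℝ, MeasurableSet A → Set.InjOn (fun x => R.eval x) A →
    ν ((fun x => R.eval x) '' A) = R.natDegree * ν A

/-- The density of states `ν(E) = N⁻¹ ∑ᵢ ∫_{σ(Δ_p)} χ_E(Sᵢ(x)) ν_p(dx)` of the almost Mathieu
operator with inverse branches `S 0, …, S (N-1)`, as a measure on the real line. -/
def densityOfStates (p : ℝ) (hp : p ∈ Set.Ioo (0 : ℝ) 1) {N : ℕ} (S : Fin N → ℝ → ℝ)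
    (νp : Measure ℝ) : Measure ℝ :=
  (N : ENNReal)⁻¹ • ∑ i, (νp.restrict (lapSpectrum p hp)).map (S i)

end SelfSimilarAMO

end

/-!
The measure identity is soft. A balanced measure `ν` of a polynomial of degree at least two has no
atoms, because `ν {R y} = deg R * ν {y}` (`IsBalancedMeasure.nullSingletonClass`). Two branches
`S i ≠ S j` meet only over critical values of `R`, hence over finitely many points, and each `S j`
is injective on `[0, 2] ⊇ σ(Δ_p)`, with inverse `R`. So in `∑ᵢ ν (Sᵢ⁻¹ (S j '' E))` the term `i = j`
is `ν E` and all others vanish (`densityOfStates_image`).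

The existence of `R` and of its branches rests on the solution `u₀ = 1, u₁, …` of the three-term
recurrence `H u = z u`, where `u_x` is a polynomial of degree `x` in `z`. With `N = 3^n`, this
solution and its image under the symmetry `x ↦ N - x` of `H` have the boundary values `(1, u_N)` and
`(u_N, 1)`, and `(H - z) u` is supported at `N`. This determines the Schur complement and gives
`R = 1 - u_N` (`amoDecimation_isSpectralDecimation`). If `t = u_N(z)` is in `[-1, 1]`, then `z` is
real: applying Green's identity to `u` and to `u` plus or minus its reflection shows that
`(t + 1) s` and `(t - 1) s` have the same strict sign for a real number `s` as soon as `z` is not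
real (`im_eq_zero_of_amoDecimation`). Hence `R - x` has only real roots for `x ∈ [0, 2]`, and the
ordered roots depend continuously on `x` by a closed graph argument (`exists_isInverseBranches`).

The polynomial `R_{Δ_p}` is the case `β = 1`, `k = 0`, `n = 1`, so it too has continuous inverse
branches. They preserve the compact set of points of `[0, 2]` in the Julia set, and a stationary
measure `ν = 3⁻¹ ∑ᵢ (Sᵢ)₊ ν` on that set exists by the Krylov–Bogoliubov argument
(`exists_stationary_measure`). As the three branches never all coincide, `ν` has no atoms, and then
it is balanced (`exists_isBalancedMeasure`).
-/

namespace SelfSimilarAMO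

/-! ### The reflection symmetry of the truncated operator -/

theorem padicValNat_three_pow_mul {m y : ℕ} (hy : ¬ 3 ∣ y) : padicValNat 3 (3 ^ m * y) = m := by
  have h0 : y ≠ 0 := by rintro rfl; simp at hy
  rw [padicValNat.mul (by positivity) h0, padicValNat.prime_pow,
    padicValNat.eq_zero_of_not_dvd hy, add_zero]

/-- The transition probabilities on `{0, …, 3^n}` are exchanged by the reflection `x ↦ 3^n - x`. -/
theorem stepRight_reflect (p : ℝ) {n x : ℕ} (h0 : 0 < x) (hx : x < 3 ^ n) :
    stepRight p (3 ^ n - x) = stepLeft p x := by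
  obtain ⟨m, y, hy, rfl⟩ := Nat.exists_eq_pow_mul_and_not_dvd h0.ne' 3 (by norm_num)
  have hmn : m < n := by
    by_contra hcon
    have h1 : 3 ^ n ≤ 3 ^ m := Nat.pow_le_pow_right (by norm_num) (not_lt.1 hcon)
    have h2 : 0 < y := Nat.pos_of_ne_zero (by rintro rfl; simp at hy)
    nlinarith [Nat.mul_le_mul_left (3 ^ m) h2]
  obtain ⟨d, rfl⟩ := Nat.exists_eq_add_of_lt hmn
  have e : 3 ^ (m + d + 1) - 3 ^ m * y = 3 ^ m * (3 * 3 ^ d - y) := by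
    rw [Nat.mul_sub]; congr 1; ring
  have hlt : y < 3 * 3 ^ d := by
    have : 3 ^ m * y < 3 ^ m * (3 * 3 ^ d) := by
      calc 3 ^ m * y < _ := hx
        _ = _ := by ring
    exact lt_of_mul_lt_mul_left this (by positivity)
  have hy' : ¬ 3 ∣ 3 * 3 ^ d - y := by omega
  have hpos : 0 < 3 ^ m := by positivity
  unfold stepRight stepLeft
  rw [e, padicValNat_three_pow_mul hy, padicValNat_three_pow_mul hy',
    Nat.mul_div_cancel_left _ hpos, Nat.mul_div_cancel_left _ hpos,
    if_neg (mul_ne_zero hpos.ne' (by omega)), if_neg h0.ne']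
  by_cases h : y % 3 = 1
  · rw [if_pos h, if_neg (by omega)]
  · rw [if_neg h, if_pos (by omega)]

/-- The diagonal entry of the truncated operator at the vertex `x`, for the frequency `k / 3^n`. -/
noncomputable def amoDiag (β : ℝ) (n k x : ℕ) : ℝ :=
  β * Real.cos (2 * Real.pi * ((k : ℝ) / 3 ^ n) * x + 0)

theorem amoDiag_reflect (β : ℝ) (n k : ℕ) {x : ℕ} (hx : x ≤ 3 ^ n) :
    amoDiag β n k (3 ^ n - x) = amoDiag β n k x := by
  unfold amoDiag
  rw [Nat.cast_sub hx, ← Real.cos_nat_mul_two_pi_sub _ k]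
  congr 2
  push_cast
  field_simp
  ring

/-- The truncated operator is invariant under the reflection `x ↦ 3^n - x`. -/
theorem amoMatrix_rev (p β : ℝ) (n k : ℕ) (i j : Fin (3 ^ n + 1)) :
    amoMatrix p β ((k : ℝ) / 3 ^ n) 0 n i.rev j.rev =
      amoMatrix p β ((k : ℝ) / 3 ^ n) 0 n i j := by
  have hN : 0 < 3 ^ n := by positivity
  obtain ⟨i, hi⟩ := i
  obtain ⟨j, hj⟩ := j
  have hR : stepRight p 0 = 1 := by simp [stepRight]
  have hd := amoDiag_reflect β n k (x := i) (by omega)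
  have ei : 3 ^ n + 1 - (i + 1) = 3 ^ n - i := by omega
  have ej : 3 ^ n + 1 - (j + 1) = 3 ^ n - j := by omega
  unfold amoDiag at hd
  simp only [amoMatrix, Matrix.of_apply, Fin.rev, Fin.mk.injEq, ei, ej]
  by_cases h1 : i = j
  · subst h1
    rw [if_pos rfl, if_pos rfl]
    exact hd
  rw [if_neg h1, if_neg (by omega)]
  by_cases h2 : j = i + 1
  · subst h2
    rw [if_neg (by omega), if_pos (by omega), if_pos rfl]
    rcases Nat.eq_zero_or_pos i with rfl | hi0
    · rw [if_pos (by omega), hR]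
    · rw [if_neg (by omega), ← stepRight_reflect p (n := n) (x := 3 ^ n - i) (by omega) (by omega)]
      congr 2
      omega
  rw [if_neg h2]
  by_cases h3 : i = j + 1
  · subst h3
    rw [if_pos (by omega), if_pos rfl]
    split_ifs with h4
    · rw [h4, Nat.sub_self, hR]
    · rw [stepRight_reflect p (by omega) (by omega)]
  · rw [if_neg h3, if_neg (by omega), if_neg (by omega)]

/-! ### The solution of the eigenvalue recurrence -/

/-- The polynomials `u₀ = 1, u₁, u₂, …` in `z` which solve the equation `H u = z u` at all vertices
`0, …, 3^n - 1`. -/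
noncomputable def amoSol (p β : ℝ) (n k : ℕ) : ℕ → ℝ[X]
  | 0 => 1
  | 1 => C (amoDiag β n k 0) - X
  | x + 2 => C (stepRight p (x + 1))⁻¹ * ((C (amoDiag β n k (x + 1)) - X) * amoSol p β n k (x + 1) -
      C (stepLeft p (x + 1)) * amoSol p β n k x)

theorem natDegree_C_sub_X (a : ℝ) : (C a - X : ℝ[X]).natDegree = 1 := by
  rw [← natDegree_neg, neg_sub, natDegree_X_sub_C]

theorem natDegree_C_sub_X_mul_sub {f g : ℝ[X]} {m : ℕ} (hf : f.natDegree = m) (hf0 : f ≠ 0)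
    (hg : g.natDegree < m + 1) (a : ℝ) :
    ((C a - X) * f - g).natDegree = m + 1 := by
  have h1 : ((C a - X) * f).natDegree = m + 1 := by
    rw [natDegree_mul (ne_zero_of_natDegree_gt (n := 0) (by rw [natDegree_C_sub_X]; norm_num)) hf0,
      natDegree_C_sub_X, hf, add_comm]
  rw [natDegree_sub_eq_left_of_natDegree_lt (by rw [h1]; exact hg), h1]

theorem amoSol_natDegree {p : ℝ} (hp : p ∈ Set.Ioo (0 : ℝ) 1) (β : ℝ) (n k x : ℕ) :
    amoSol p β n k x ≠ 0 ∧ (amoSol p β n k x).natDegree = x := by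
  induction x using Nat.strong_induction_on with
  | _ x ih =>
    match x with
    | 0 => simp [amoSol]
    | 1 =>
      have h : (amoSol p β n k 1).natDegree = 1 := natDegree_C_sub_X _
      exact ⟨ne_zero_of_natDegree_gt (n := 0) (by omega), h⟩
    | x + 2 =>
      have h : (amoSol p β n k (x + 2)).natDegree = x + 2 := by
        rw [amoSol, natDegree_C_mul (inv_ne_zero (stepRight_pos hp _).ne')]
        refine natDegree_C_sub_X_mul_sub (ih (x + 1) (by omega)).2 (ih (x + 1) (by omega)).1 ?_ _
        refine (natDegree_C_mul_le _ _).trans_lt ?_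
        rw [(ih x (by omega)).2]
        omega
      exact ⟨ne_zero_of_natDegree_gt (n := 0) (by omega), h⟩

/-- The polynomial by which `H u - z u` fails to vanish at the last vertex `3^n`. -/
noncomputable def amoDefect (p β : ℝ) (n k : ℕ) : ℝ[X] :=
  (C (amoDiag β n k (3 ^ n)) - X) * amoSol p β n k (3 ^ n) - amoSol p β n k (3 ^ n - 1)

theorem amoDefect_ne_zero {p : ℝ} (hp : p ∈ Set.Ioo (0 : ℝ) 1) (β : ℝ) (n k : ℕ) :
    amoDefect p β n k ≠ 0 := by
  have hN : 0 < 3 ^ n := by positivity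
  have h := natDegree_C_sub_X_mul_sub (amoSol_natDegree hp β n k (3 ^ n)).2
    (amoSol_natDegree hp β n k (3 ^ n)).1 (g := amoSol p β n k (3 ^ n - 1))
    (by rw [(amoSol_natDegree hp β n k (3 ^ n - 1)).2]; omega) (amoDiag β n k (3 ^ n))
  exact ne_zero_of_natDegree_gt (n := 0) (by rw [amoDefect, h]; exact Nat.succ_pos _)

section Pencil

variable {A : Type*} [CommRing A] [Algebra ℝ A]

/-- `H^{(n)} - z` for a point `z` of a commutative real algebra. -/
noncomputable def amoPencil (p β : ℝ) (n k : ℕ) (z : A) :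
    Matrix (Fin (3 ^ n + 1)) (Fin (3 ^ n + 1)) A :=
  (amoMatrix p β ((k : ℝ) / 3 ^ n) 0 n).map (algebraMap ℝ A) -
    z • (1 : Matrix (Fin (3 ^ n + 1)) (Fin (3 ^ n + 1)) A)

/-- The solution of the recurrence on the vertices `0, …, 3^n`, at the spectral parameter `z`. -/
noncomputable def amoVec (p β : ℝ) (n k : ℕ) (z : A) (i : Fin (3 ^ n + 1)) : A :=
  aeval z (amoSol p β n k i)

theorem amoPencil_rev (p β : ℝ) (n k : ℕ) (z : A) (i j : Fin (3 ^ n + 1)) :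
    amoPencil p β n k z i.rev j.rev = amoPencil p β n k z i j := by
  simp [amoPencil, amoMatrix_rev, Matrix.one_apply]

theorem amoPencil_mulVec_rev (p β : ℝ) (n k : ℕ) (z : A) (v : Fin (3 ^ n + 1) → A)
    (i : Fin (3 ^ n + 1)) :
    (amoPencil p β n k z).mulVec (fun j => v j.rev) i =
      (amoPencil p β n k z).mulVec v i.rev := by
  simp only [Matrix.mulVec, dotProduct]
  refine Fintype.sum_equiv Fin.revPerm _ _ fun j => ?_
  rw [Fin.revPerm_apply, amoPencil_rev]

/-- `H - z` as a tridiagonal matrix: the action on the restriction of a sequence, with the row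
indexed by a natural number. -/
theorem amoPencil_mulVec (p β : ℝ) (n k : ℕ) (z : A) (g : ℕ → A) (i : Fin (3 ^ n + 1)) :
    (amoPencil p β n k z).mulVec (fun j => g j) i =
      ∑ j ∈ Finset.range (3 ^ n + 1),
        ((if j = i then (algebraMap ℝ A (amoDiag β n k i) - z) * g i else 0) +
          (if j = (i : ℕ) + 1 then -algebraMap ℝ A (stepRight p i) * g (i + 1) else 0) +
          (if j + 1 = (i : ℕ) then
            -algebraMap ℝ A (if (i : ℕ) = 3 ^ n then 1 else stepLeft p i) * g (i - 1) else 0)) := by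
  rw [← Fin.sum_univ_eq_sum_range (fun j =>
    ((if j = i then (algebraMap ℝ A (amoDiag β n k i) - z) * g i else 0) +
          (if j = (i : ℕ) + 1 then -algebraMap ℝ A (stepRight p i) * g (i + 1) else 0) +
          (if j + 1 = (i : ℕ) then
            -algebraMap ℝ A (if (i : ℕ) = 3 ^ n then 1 else stepLeft p i) * g (i - 1) else 0)))]
  simp only [Matrix.mulVec, dotProduct]
  refine Finset.sum_congr rfl fun j _ => ?_
  simp only [amoPencil, amoMatrix, Matrix.sub_apply, Matrix.map_apply, Matrix.of_apply,
    Matrix.smul_apply, Matrix.one_apply, smul_eq_mul, Fin.ext_iff]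
  by_cases h1 : (i : ℕ) = j
  · rw [if_pos h1, if_pos h1, if_pos h1.symm, if_neg (by omega), if_neg (by omega), h1]
    simp [amoDiag]
  rw [if_neg h1, if_neg h1, if_neg (Ne.symm h1)]
  by_cases h2 : (j : ℕ) = i + 1
  · rw [if_pos h2, if_pos h2, if_neg (by omega), h2]
    simp
  rw [if_neg h2, if_neg h2]
  by_cases h3 : (i : ℕ) = j + 1
  · rw [if_pos h3, if_pos h3.symm]
    have : (i : ℕ) - 1 = j := by omega
    rw [this]
    split_ifs <;> simp
  · rw [if_neg h3, if_neg (by omega)]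
    simp

theorem amoPencil_mulVec_amoVec_of_lt {p : ℝ} (hp : p ∈ Set.Ioo (0 : ℝ) 1) (β : ℝ) (n k : ℕ) (z : A)
    (i : Fin (3 ^ n + 1)) (hi : (i : ℕ) < 3 ^ n) :
    (amoPencil p β n k z).mulVec (amoVec p β n k z) i = 0 := by
  have h := amoPencil_mulVec p β n k z (fun x => aeval z (amoSol p β n k x)) i
  change (amoPencil p β n k z).mulVec (fun j => aeval z (amoSol p β n k j)) i = 0
  rw [h]
  obtain ⟨i, hi'⟩ := i
  simp only at hi ⊢
  rw [Finset.sum_add_distrib, Finset.sum_add_distrib, Finset.sum_ite_eq', Finset.sum_ite_eq',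
    if_pos (by simp; omega), if_pos (by simp; omega)]
  cases i with
  | zero => simp [amoSol, stepRight]
  | succ x =>
    simp only [add_left_inj, Nat.add_sub_cancel]
    rw [Finset.sum_ite_eq', if_pos (by simp; omega), if_neg (by omega), amoSol]
    have h1 : algebraMap ℝ A (stepRight p (x + 1)) * algebraMap ℝ A (stepRight p (x + 1))⁻¹ = 1 := by
      rw [← map_mul, mul_inv_cancel₀ (stepRight_pos hp _).ne', map_one]
    simp only [map_mul, map_sub, aeval_C, aeval_X]
    linear_combination (-((algebraMap ℝ A (amoDiag β n k (x + 1)) - z) *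
      aeval z (amoSol p β n k (x + 1)) - algebraMap ℝ A (stepLeft p (x + 1)) *
      aeval z (amoSol p β n k x))) * h1

theorem amoPencil_mulVec_amoVec_last (p β : ℝ) (n k : ℕ) (z : A) :
    (amoPencil p β n k z).mulVec (amoVec p β n k z) (Fin.last _) = aeval z (amoDefect p β n k) := by
  have h := amoPencil_mulVec p β n k z (fun x => aeval z (amoSol p β n k x)) (Fin.last _)
  change (amoPencil p β n k z).mulVec (fun j => aeval z (amoSol p β n k j)) _ = _
  have hN : 0 < 3 ^ n := by positivity
  rw [h, amoDefect]
  obtain ⟨N, hN'⟩ : ∃ N, 3 ^ n = N + 1 := ⟨3 ^ n - 1, by omega⟩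
  rw [Finset.sum_add_distrib, Finset.sum_add_distrib, Finset.sum_ite_eq', Finset.sum_ite_eq',
    if_pos (by simp), if_neg (by simp)]
  simp only [Fin.val_last, hN', add_left_inj]
  rw [Finset.sum_ite_eq', if_pos (by simp)]
  simp only [map_mul, map_sub, aeval_C, aeval_X]
  simp
  ring

end Pencil

/-! ### The Schur complement onto the boundary -/

theorem sum_fin_eq_bdry_add_inner {F : Type*} [AddCommMonoid F] {N : ℕ} (hN : 0 < N)
    (g : Fin (N + 1) → F) :
    ∑ y, g y = g 0 + g (Fin.last N) +
      ∑ i : Fin (N - 1), g ⟨(i : ℕ) + 1, by have := i.isLt; omega⟩ := by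
  obtain ⟨m, rfl⟩ : ∃ m, N = m + 1 := ⟨N - 1, by omega⟩
  rw [Fin.sum_univ_succ, Fin.sum_univ_castSucc, add_assoc (g 0)]
  exact congrArg (g 0 + ·) (add_comm _ _)

theorem mulVec_eq_bdry_add_inner {F : Type*} [CommRing F] {n m : ℕ}
    (M : Matrix (Fin (3 ^ n + 1)) (Fin (3 ^ n + 1)) F) (v : Fin (3 ^ n + 1) → F)
    (e : Fin m → Fin (3 ^ n + 1)) :
    (fun i => M.mulVec v (e i)) = (M.submatrix e (bdry n)).mulVec (fun i => v (bdry n i)) +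
      (M.submatrix e (inner n)).mulVec (fun i => v (inner n i)) := by
  funext i
  simp only [Matrix.mulVec, dotProduct, Pi.add_apply, Matrix.submatrix_apply, Fin.sum_univ_two]
  exact sum_fin_eq_bdry_add_inner (by positivity) _

/-- A vector which solves `M v = 0` at all interior vertices is mapped by the Schur complement
onto the boundary to the boundary values of `M v`. -/
theorem schur_mulVec {F : Type*} [Field F] {n : ℕ}
    (M : Matrix (Fin (3 ^ n + 1)) (Fin (3 ^ n + 1)) F)
    (hM : (M.submatrix (inner n) (inner n)).det ≠ 0) (v : Fin (3 ^ n + 1) → F)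
    (hv : ∀ i, M.mulVec v (inner n i) = 0) :
    (M.submatrix (bdry n) (bdry n) - M.submatrix (bdry n) (inner n) *
      (M.submatrix (inner n) (inner n))⁻¹ * M.submatrix (inner n) (bdry n)).mulVec
        (fun i => v (bdry n i)) = fun i => M.mulVec v (bdry n i) := by
  have h1 := mulVec_eq_bdry_add_inner M v (inner n)
  have h0 : (fun i => M.mulVec v (inner n i)) = 0 := funext hv
  rw [h0] at h1
  have h2 : (M.submatrix (inner n) (bdry n)).mulVec (fun i => v (bdry n i)) =
      -(M.submatrix (inner n) (inner n)).mulVec (fun i => v (inner n i)) :=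
    eq_neg_of_add_eq_zero_left h1.symm
  rw [mulVec_eq_bdry_add_inner M v (bdry n), Matrix.sub_mulVec, ← Matrix.mulVec_mulVec, h2,
    ← Matrix.mulVec_mulVec, Matrix.mulVec_neg, Matrix.mulVec_mulVec _ _⁻¹,
    Matrix.nonsing_inv_mul _ (isUnit_iff_ne_zero.2 hM), Matrix.one_mulVec, Matrix.mulVec_neg,
    sub_neg_eq_add]

/-- `B - z` is invertible over the rational functions in `z`. -/
theorem det_map_sub_X_ne_zero {m : ℕ} (B : Matrix (Fin m) (Fin m) ℝ) :
    (B.map (algebraMap ℝ (RatFunc ℝ)) -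
      (RatFunc.X : RatFunc ℝ) • (1 : Matrix (Fin m) (Fin m) (RatFunc ℝ))).det ≠ 0 := by
  have h : B.map (algebraMap ℝ (RatFunc ℝ)) -
      (RatFunc.X : RatFunc ℝ) • (1 : Matrix (Fin m) (Fin m) (RatFunc ℝ)) =
      -(algebraMap ℝ[X] (RatFunc ℝ)).mapMatrix B.charmatrix := by
    ext i j
    by_cases hij : i = j <;>
      simp [hij, RatFunc.algebraMap_X, RatFunc.algebraMap_C, RatFunc.algebraMap_eq_C]
  rw [h, Matrix.det_neg, ← RingHom.map_det]
  refine mul_ne_zero (pow_ne_zero _ (by norm_num)) ?_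
  rw [Ne, FaithfulSMul.algebraMap_eq_zero_iff]
  exact (Matrix.charpoly_monic B).ne_zero

/-- The spectral decimation polynomial `1 - u_{3^n}`. -/
noncomputable def amoDecimation (p β : ℝ) (n k : ℕ) : ℝ[X] := 1 - amoSol p β n k (3 ^ n)

theorem amoDecimation_natDegree {p : ℝ} (hp : p ∈ Set.Ioo (0 : ℝ) 1) (β : ℝ) (n k : ℕ) :
    (amoDecimation p β n k).natDegree = 3 ^ n := by
  have hN : 0 < 3 ^ n := by positivity
  have h := (amoSol_natDegree hp β n k (3 ^ n)).2
  rw [amoDecimation, natDegree_sub_eq_right_of_natDegree_lt (by rw [h, natDegree_one]; exact hN), h]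

/-- Applying the Schur complement to the boundary values `(1, u_N)` and `(u_N, 1)` of the solution
and of its reflection determines all four of its entries. -/
theorem amoDecimation_isSpectralDecimation {p : ℝ} (hp : p ∈ Set.Ioo (0 : ℝ) 1) (β : ℝ)
    (n k : ℕ) : IsSpectralDecimation p β n k (amoDecimation p β n k) := by
  have hN : 0 < 3 ^ n := by positivity
  set ι := algebraMap ℝ[X] (RatFunc ℝ) with hι
  have haeval : ∀ q : ℝ[X], aeval (RatFunc.X : RatFunc ℝ) q = ι q := fun q => by
    rw [← RatFunc.algebraMap_X, aeval_algebraMap_apply, aeval_X_left_apply]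
  have hinj : Function.Injective ι := FaithfulSMul.algebraMap_injective _ _
  set t := ι (amoSol p β n k (3 ^ n)) with ht
  set d := ι (amoDefect p β n k) with hd
  set M := amoPencil p β n k (RatFunc.X : RatFunc ℝ) with hM
  set v := amoVec p β n k (RatFunc.X : RatFunc ℝ) with hv
  have hdet : (M.submatrix (inner n) (inner n)).det ≠ 0 := by
    have h := det_map_sub_X_ne_zero
      ((amoMatrix p β ((k : ℝ) / 3 ^ n) 0 n).submatrix (inner n) (inner n))
    convert h using 2
    ext i j
    have hinner : Function.Injective (inner n) := fun a b hab => by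
      simp only [inner, Fin.mk.injEq, add_left_inj] at hab
      exact Fin.ext hab
    simp [hM, amoPencil, Matrix.one_apply, hinner.eq_iff]
  have hrow : ∀ i : Fin (3 ^ n + 1), (i : ℕ) < 3 ^ n → M.mulVec v i = 0 :=
    amoPencil_mulVec_amoVec_of_lt hp β n k _
  have hlast : M.mulVec v (Fin.last _) = d := by
    rw [hd, ← haeval]
    exact amoPencil_mulVec_amoVec_last p β n k _
  have hv0 : v 0 = 1 := by simp [hv, amoVec, amoSol]
  have hvN : v (Fin.last _) = t := by simp [hv, amoVec, ht, haeval]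
  have s1 := schur_mulVec M hdet v fun i => hrow _ (by have := i.isLt; simp only [inner]; omega)
  have s2 := schur_mulVec M hdet (fun j => v j.rev) fun i => by
    rw [hM, amoPencil_mulVec_rev]
    exact hrow _ (by simp only [inner, Fin.rev]; omega)
  have hS : amoSchur p β ((k : ℝ) / 3 ^ n) 0 n = M.submatrix (bdry n) (bdry n) -
      M.submatrix (bdry n) (inner n) * (M.submatrix (inner n) (inner n))⁻¹ *
        M.submatrix (inner n) (bdry n) := rfl
  rw [← hS] at s1 s2
  set S := amoSchur p β ((k : ℝ) / 3 ^ n) 0 n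
  have h00 := congrFun s1 0
  have h01 := congrFun s1 1
  have h10 := congrFun s2 0
  have h11 := congrFun s2 1
  have hr0 := amoPencil_mulVec_rev p β n k (RatFunc.X : RatFunc ℝ) v 0
  have hrN := amoPencil_mulVec_rev p β n k (RatFunc.X : RatFunc ℝ) v (Fin.last _)
  rw [← hM, Fin.rev_zero, hlast] at hr0
  rw [← hM, Fin.rev_last, hrow 0 (by simp)] at hrN
  simp only [Matrix.mulVec, dotProduct, Fin.sum_univ_two] at h00 h01 h10 h11
  change S 0 0 * v 0 + S 0 1 * v (Fin.last _) = M.mulVec v 0 at h00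
  change S 1 0 * v 0 + S 1 1 * v (Fin.last _) = M.mulVec v (Fin.last _) at h01
  change S 0 0 * v (Fin.rev 0) + S 0 1 * v (Fin.rev (Fin.last _)) =
    M.mulVec (fun j => v j.rev) 0 at h10
  change S 1 0 * v (Fin.rev 0) + S 1 1 * v (Fin.rev (Fin.last _)) =
    M.mulVec (fun j => v j.rev) (Fin.last _) at h11
  rw [Fin.rev_zero, Fin.rev_last, hv0, hvN] at h10 h11
  rw [hr0] at h10
  rw [hrN] at h11
  rw [hv0, hvN] at h00 h01
  rw [hrow 0 (by simp)] at h00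
  rw [hlast] at h01
  have hd0 : d ≠ 0 := by
    rw [hd, Ne, map_eq_zero_iff _ hinj]
    exact amoDefect_ne_zero hp β n k
  have ht2 : 1 - t * t ≠ 0 := by
    rw [ht, ← map_mul, ← map_one ι, ← map_sub, Ne, map_eq_zero_iff _ hinj]
    obtain ⟨h0, h1⟩ := amoSol_natDegree hp β n k (3 ^ n)
    have h2 := natDegree_mul h0 h0
    intro h
    rw [← sub_eq_zero.1 h, natDegree_one] at h2
    omega
  have hb : S 0 1 * (1 - t * t) = d := by linear_combination h10 - t * h00
  have hb' : S 1 0 * (1 - t * t) = d := by linear_combination h01 - t * h11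
  have hb0 : S 0 1 ≠ 0 := by
    intro h
    rw [h, zero_mul] at hb
    exact hd0 hb.symm
  have hsym : S 1 0 = S 0 1 := mul_right_cancel₀ ht2 (hb'.trans hb.symm)
  refine ⟨-S 0 1, -(S 0 1 * (1 - t)), neg_ne_zero.2 hb0, ?_, ?_⟩
  · ext i j
    fin_cases i <;> fin_cases j <;> simp [lapZero]
    · linear_combination h00
    · rfl
    · exact hsym
    · rw [hsym] at h11
      change S 1 1 = _
      linear_combination h11
  · rw [amoDecimation, map_sub, map_one, ← ht, neg_div_neg_eq, mul_div_cancel_left₀ _ hb0]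

/-! ### Green's identity and real-rootedness -/

theorem im_sum_star_mul_mulVec {ι : Type*} [Fintype ι] [DecidableEq ι] (M : Matrix ι ι ℝ)
    (ω : ι → ℝ) (hω : ∀ i j, ω i * M i j = ω j * M j i) (z : ℂ) (f : ι → ℂ) :
    (∑ i, (ω i : ℂ) * star (f i) *
      (M.map (algebraMap ℝ ℂ) - z • (1 : Matrix ι ι ℂ)).mulVec f i).im =
        -(z.im * ∑ i, ω i * ‖f i‖ ^ 2) := by
  set Q : ℂ := ∑ i, ∑ j, (ω i : ℂ) * star (f i) * ((M i j : ℂ) * f j) with hQ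
  have hreal : star Q = Q := by
    rw [hQ, star_sum]
    simp only [star_sum, star_mul', star_star]
    rw [Finset.sum_comm]
    refine Finset.sum_congr rfl fun i _ => Finset.sum_congr rfl fun j _ => ?_
    have h : (ω i : ℂ) * M i j = ω j * M j i := by exact_mod_cast hω i j
    simp only [Complex.star_def, Complex.conj_ofReal]
    linear_combination (-(starRingEnd ℂ (f i)) * f j) * h
  have him : Q.im = 0 := Complex.conj_eq_iff_im.1 hreal
  have h : ∑ i, (ω i : ℂ) * star (f i) *
      (M.map (algebraMap ℝ ℂ) - z • (1 : Matrix ι ι ℂ)).mulVec f i =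
        Q - z * ((∑ i, ω i * ‖f i‖ ^ 2 : ℝ) : ℂ) := by
    rw [hQ]
    push_cast
    rw [Finset.mul_sum, ← Finset.sum_sub_distrib]
    refine Finset.sum_congr rfl fun i _ => ?_
    rw [Matrix.sub_mulVec, Pi.sub_apply, Matrix.smul_mulVec, Matrix.one_mulVec, Pi.smul_apply,
      smul_eq_mul, ← Complex.conj_mul', mul_sub]
    simp only [Matrix.mulVec, dotProduct, Matrix.map_apply, Finset.mul_sum]
    congr 1
    rw [Complex.star_def]
    ring
  rw [h, Complex.sub_im, him, Complex.mul_im, Complex.ofReal_im, Complex.ofReal_re]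
  ring

/-- Reversing weights for the walk on `{0, …, 3^n}` with reflection at both ends. -/
noncomputable def pathWeight (p : ℝ) (n : ℕ) (i : Fin (3 ^ n + 1)) : ℝ :=
  if (i : ℕ) = 3 ^ n then revWeight p (3 ^ n - 1) * stepRight p (3 ^ n - 1) else revWeight p i

theorem pathWeight_pos {p : ℝ} (hp : p ∈ Set.Ioo (0 : ℝ) 1) (n : ℕ) (i : Fin (3 ^ n + 1)) :
    0 < pathWeight p n i := by
  unfold pathWeight
  split_ifs
  · exact mul_pos (revWeight_pos hp _) (stepRight_pos hp _)
  · exact revWeight_pos hp _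

theorem pathWeight_reversible {p : ℝ} (hp : p ∈ Set.Ioo (0 : ℝ) 1) (β α θ : ℝ) (n : ℕ)
    (i j : Fin (3 ^ n + 1)) :
    pathWeight p n i * amoMatrix p β α θ n i j = pathWeight p n j * amoMatrix p β α θ n j i := by
  have key : ∀ i j : Fin (3 ^ n + 1), (j : ℕ) = i + 1 →
      pathWeight p n i * amoMatrix p β α θ n i j =
        pathWeight p n j * amoMatrix p β α θ n j i := by
    intro i j h
    have hi : (i : ℕ) ≠ 3 ^ n := by omega
    have hij : i ≠ j := by rintro rfl; omega
    simp only [pathWeight, amoMatrix, Matrix.of_apply]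
    rw [if_neg hij, if_neg hij.symm, if_pos h, if_pos h, if_neg hi, if_neg (show ¬ (i : ℕ) = j + 1 by omega)]
    split_ifs with hj
    · have : (i : ℕ) = 3 ^ n - 1 := by omega
      rw [this]
      ring
    · rw [h]
      linear_combination revWeight_reversible hp i
  rcases eq_or_ne i j with rfl | hij
  · rfl
  by_cases h1 : (j : ℕ) = i + 1
  · exact key i j h1
  by_cases h2 : (i : ℕ) = j + 1
  · exact (key j i h2).symm
  · simp [amoMatrix, hij, hij.symm, h1, h2]

/-- Green's identity for `H - z`, with positive weights which take the same value at both ends: the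
sum of the reversing weights and their reflection. -/
theorem exists_green {p : ℝ} (hp : p ∈ Set.Ioo (0 : ℝ) 1) (β : ℝ) (n k : ℕ) (z : ℂ) :
    ∃ ω : Fin (3 ^ n + 1) → ℝ, (∀ i, 0 < ω i) ∧ ω (Fin.last _) = ω 0 ∧
      ∀ f : Fin (3 ^ n + 1) → ℂ,
        (∑ i, (ω i : ℂ) * star (f i) * (amoPencil p β n k z).mulVec f i).im =
          -(z.im * ∑ i, ω i * ‖f i‖ ^ 2) := by
  refine ⟨fun i => pathWeight p n i + pathWeight p n i.rev,
    fun i => add_pos (pathWeight_pos hp _ _) (pathWeight_pos hp _ _), ?_,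
    fun f => im_sum_star_mul_mulVec _ _ (fun i j => ?_) z f⟩
  · simp only [Fin.rev_last, Fin.rev_zero, add_comm]
  · have h := pathWeight_reversible hp β ((k : ℝ) / 3 ^ n) 0 n i.rev j.rev
    rw [amoMatrix_rev, amoMatrix_rev] at h
    rw [add_mul, add_mul, h, pathWeight_reversible hp]

/-- The spectral decimation polynomial takes values in `[0, 2]` only at real points: for non-real
`z` with `t = u_N(z) ∈ [-1, 1]`, Green's identity for the solution `u` and for the sum and the
difference of `u` and its reflection gives incompatible signs. -/
theorem im_eq_zero_of_amoDecimation {p : ℝ} (hp : p ∈ Set.Ioo (0 : ℝ) 1) (β : ℝ) (n k : ℕ)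
    {x : ℝ} (hx : x ∈ Set.Icc (0 : ℝ) 2) {z : ℂ} (hz : aeval z (amoDecimation p β n k) = (x : ℂ)) :
    z.im = 0 := by
  have hN : 0 < 3 ^ n := by positivity
  by_contra hy
  obtain ⟨ω, hpos, hsym, green⟩ := exists_green hp β n k z
  set u := amoVec p β n k z with hu
  set M := amoPencil p β n k z with hM
  set d : ℂ := aeval z (amoDefect p β n k) with hd
  have hne : (0 : Fin (3 ^ n + 1)) ≠ Fin.last _ := by
    intro h
    have := congrArg Fin.val h
    simp only [Fin.val_zero, Fin.val_last] at this
    omega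
  obtain ⟨t, htx⟩ : ∃ t : ℝ, t = 1 - x := ⟨_, rfl⟩
  have hu0 : u 0 = 1 := by simp [hu, amoVec, amoSol]
  have huN : u (Fin.last _) = (t : ℂ) := by
    have : aeval z (amoDecimation p β n k) = 1 - u (Fin.last _) := by
      simp [hu, amoVec, amoDecimation]
    rw [this] at hz
    rw [htx]
    push_cast
    linear_combination -hz
  have hlast : M.mulVec u (Fin.last _) = d := amoPencil_mulVec_amoVec_last p β n k z
  have hrow : ∀ i, i ≠ Fin.last _ → M.mulVec u i = 0 := fun i hi =>
    amoPencil_mulVec_amoVec_of_lt hp β n k z i (Fin.val_lt_last hi)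
  set w : Fin (3 ^ n + 1) → ℂ := fun i => u i.rev with hw
  have hMw : ∀ i, M.mulVec w i = M.mulVec u i.rev := amoPencil_mulVec_rev p β n k z u
  have hw0 : w 0 = t := by rw [hw]; simp only [Fin.rev_zero, huN]
  have hwN : w (Fin.last _) = 1 := by rw [hw]; simp only [Fin.rev_last, hu0]
  -- Green's identity for `u + c w`: only the two boundary rows contribute.
  have gen : ∀ c : ℝ, ω 0 * ((t + c) + c * (1 + c * t)) * d.im =
      -(z.im * ∑ i, ω i * ‖u i + c * w i‖ ^ 2) := by
    intro c
    have h := green (fun i => u i + c * w i)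
    rw [← h]
    have hMf : ∀ i, M.mulVec (fun i => u i + c * w i) i = M.mulVec u i + c * M.mulVec u i.rev := by
      intro i
      have : (fun i => u i + c * w i) = u + (c : ℂ) • w := rfl
      rw [this, Matrix.mulVec_add, Matrix.mulVec_smul, Pi.add_apply, Pi.smul_apply, hMw,
        smul_eq_mul]
    simp only [hMf]
    rw [Finset.sum_eq_add_of_mem 0 (Fin.last _) (Finset.mem_univ _) (Finset.mem_univ _) hne]
    · rw [Fin.rev_zero, Fin.rev_last, hrow 0 hne, hlast, hsym, hu0, hw0, huN, hwN]
      have : (ω 0 : ℂ) * star (1 + (c : ℂ) * t) * (0 + c * d) +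
          ω 0 * star ((t : ℂ) + c * 1) * (d + c * 0) =
            ((ω 0 * ((t + c) + c * (1 + c * t)) : ℝ) : ℂ) * d := by
        simp only [Complex.star_def, map_add, map_mul, map_one, Complex.conj_ofReal]
        push_cast
        ring
      rw [this, Complex.im_ofReal_mul]
    · intro i _ hi
      rw [hrow i hi.2, hrow i.rev (fun h => hi.1 (by rw [← Fin.rev_rev i, h, Fin.rev_last]))]
      simp
  have hsum_nonneg : ∀ c : ℝ, 0 ≤ ∑ i, ω i * ‖u i + c * w i‖ ^ 2 := fun c =>
    Finset.sum_nonneg fun i _ => mul_nonneg (hpos i).le (by positivity)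
  have g0 := gen 0
  have g1 := gen 1
  have g2 := gen (-1)
  have hA : 0 < ∑ i, ω i * ‖u i + (0 : ℝ) * w i‖ ^ 2 :=
    Finset.sum_pos' (fun i _ => mul_nonneg (hpos i).le (by positivity))
      ⟨0, Finset.mem_univ _, mul_pos (hpos 0) (by simp [hu0])⟩
  have hB := hsum_nonneg 1
  have hC := hsum_nonneg (-1)
  -- A vanishing combination `u ± w` would make the defect `d` vanish.
  have hvan : ∀ c : ℝ, c ≠ 0 → ∑ i, ω i * ‖u i + c * w i‖ ^ 2 = 0 → d = 0 := by
    intro c hc h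
    rw [Finset.sum_eq_zero_iff_of_nonneg
      (fun i _ => mul_nonneg (hpos i).le (by positivity))] at h
    have h0 : u + (c : ℂ) • w = 0 := by
      funext i
      have := h i (Finset.mem_univ i)
      simpa [(hpos i).ne'] using this
    have h1 : M.mulVec (u + (c : ℂ) • w) 0 = 0 := by rw [h0, Matrix.mulVec_zero]; rfl
    rw [Matrix.mulVec_add, Matrix.mulVec_smul, Pi.add_apply, Pi.smul_apply, hMw, hrow 0 hne,
      Fin.rev_zero, hlast, smul_eq_mul, zero_add] at h1
    simpa [hc] using h1
  set s := d.im with hs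
  set a := ∑ i, ω i * ‖u i + (0 : ℝ) * w i‖ ^ 2
  set b := ∑ i, ω i * ‖u i + (1 : ℝ) * w i‖ ^ 2
  set c := ∑ i, ω i * ‖u i + ((-1 : ℝ) : ℝ) * w i‖ ^ 2
  have hs0 : s ≠ 0 := by
    intro h
    rw [h, mul_zero] at g0
    have := mul_ne_zero hy hA.ne'
    exact this (by linarith)
  have hd0 : d ≠ 0 := fun h => hs0 (by rw [hs, h, Complex.zero_im])
  have hb : 0 < b := lt_of_le_of_ne hB fun h => hd0 (hvan 1 one_ne_zero h.symm)
  have hc : 0 < c := lt_of_le_of_ne hC fun h => hd0 (hvan (-1) (by norm_num) h.symm)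
  have hprod : (2 * ω 0 * s) ^ 2 * ((t + 1) * (t - 1)) = z.im ^ 2 * (b * c) := by
    have e1 : 2 * ω 0 * s * (t + 1) = -(z.im * b) := by linear_combination g1
    have e2 : 2 * ω 0 * s * (t - 1) = -(z.im * c) := by linear_combination g2
    calc _ = (2 * ω 0 * s * (t + 1)) * (2 * ω 0 * s * (t - 1)) := by ring
      _ = _ := by rw [e1, e2]; ring
  have h1 : 0 < z.im ^ 2 * (b * c) := mul_pos (by positivity) (mul_pos hb hc)
  have h2 : (t + 1) * (t - 1) ≤ 0 := by
    rw [htx]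
    exact mul_nonpos_of_nonneg_of_nonpos (by linarith [hx.2]) (by linarith [hx.1])
  rw [← hprod] at h1
  exact absurd (mul_nonpos_of_nonneg_of_nonpos (sq_nonneg (2 * ω 0 * s)) h2) (not_le.2 h1)

/-- For `β = 1`, `k = 0` and `n = 1` the truncated operator is that of the Laplacian. -/
theorem lapDecimation_eq_amoDecimation {p : ℝ} (hp : p ∈ Set.Ioo (0 : ℝ) 1) :
    lapDecimation p = amoDecimation p 1 1 0 := by
  have hp0 : p ≠ 0 := hp.1.ne'
  have hp1 : 1 - p ≠ 0 := by linarith [hp.2]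
  have r1 : stepRight p 1 = p := by simp [stepRight]
  have r2 : stepRight p 2 = 1 - p := by
    have : padicValNat 3 2 = 0 := padicValNat.eq_zero_of_not_dvd (by norm_num)
    simp [stepRight, this]
  have l1 : stepLeft p 1 = 1 - p := by linarith [stepLeft_add_stepRight p 1]
  have l2 : stepLeft p 2 = p := by linarith [stepLeft_add_stepRight p 2]
  have hd : ∀ x, amoDiag 1 1 0 x = 1 := fun x => by simp [amoDiag]
  refine Polynomial.funext fun z => ?_
  simp only [lapDecimation, amoDecimation, pow_one, amoSol, hd, r1, r2, l1, l2, zero_add,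
    Nat.reduceAdd, eval_mul, eval_sub, eval_add, eval_C, eval_X, eval_one]
  field_simp
  ring

/-! ### Continuous branches of the inverse of a real-rooted family -/

theorem exists_monotone_map_univ_eq {N : ℕ} (m : Multiset ℝ) (hm : m.card = N) :
    ∃ s : Fin N → ℝ, Monotone s ∧ Finset.univ.val.map s = m := by
  subst hm
  have hl : (m.sort (· ≤ ·)).length = m.card := Multiset.length_sort _
  refine ⟨fun i => (m.sort (· ≤ ·)).get (i.cast hl.symm), fun i j hij => ?_, ?_⟩
  · exact (Multiset.pairwise_sort m (· ≤ ·)).sortedLE.monotone_get hij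
  · rw [Fin.univ_val_map]
    conv_rhs => rw [← Multiset.sort_eq m (· ≤ ·)]
    congr 1
    refine List.ext_get (by simp) fun i h1 h2 => by simp

theorem eq_of_map_univ_eq_of_monotone {N : ℕ} {s s' : Fin N → ℝ} (hs : Monotone s)
    (hs' : Monotone s') (h : Finset.univ.val.map s = Finset.univ.val.map s') : s = s' := by
  rw [Fin.univ_val_map, Fin.univ_val_map, Multiset.coe_eq_coe] at h
  exact List.ofFn_injective (h.eq_of_sortedLE hs.sortedLE_ofFn hs'.sortedLE_ofFn)

theorem eq_of_prod_sub_eq {N : ℕ} {s s' : Fin N → ℝ} (hs : Monotone s) (hs' : Monotone s')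
    (h : ∀ y : ℝ, ∏ j, (y - s j) = ∏ j, (y - s' j)) : s = s' := by
  refine eq_of_map_univ_eq_of_monotone hs hs' ?_
  have hp : ∏ j, (X - C (s j)) = ∏ j, (X - C (s' j)) :=
    Polynomial.funext fun y => by simpa [eval_prod] using h y
  have hroots : ∀ r : Fin N → ℝ, (∏ j, (X - C (r j))).roots = Finset.univ.val.map r := fun r => by
    have := roots_multiset_prod_X_sub_C (Finset.univ.val.map r)
    rwa [Multiset.map_map] at this
  rw [← hroots, ← hroots, hp]

/-- If a real polynomial takes values in `[0, 2]` only on the real line, then the increasingly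
ordered solutions of `R(z) = x` are continuous in `x ∈ [0, 2]`: they stay in a compact set, and
their graph is closed, being cut out by the factorization of `R - x`. -/
theorem exists_isInverseBranches {R : ℝ[X]} {N : ℕ} (hdeg : R.natDegree = N) (hN : 0 < N)
    (hreal : ∀ x ∈ Set.Icc (0 : ℝ) 2, ∀ z : ℂ, aeval z R = (x : ℂ) → z.im = 0) :
    ∃ S : Fin N → ℝ → ℝ, IsInverseBranches R S := by
  have hdegx : ∀ x : ℝ, ((R - C x).map (algebraMap ℝ ℂ)).natDegree = N := fun x => by
    rw [natDegree_map, natDegree_sub_C, hdeg]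
  have hlcx : ∀ x : ℝ, ((R - C x).map (algebraMap ℝ ℂ)).leadingCoeff = R.leadingCoeff := fun x => by
    rw [leadingCoeff_map, leadingCoeff_sub_of_degree_lt]
    · rfl
    · exact degree_C_le.trans_lt (natDegree_pos_iff_degree_pos.1 (hdeg ▸ hN))
  have hex : ∀ x : Set.Icc (0 : ℝ) 2, ∃ s : Fin N → ℝ, Monotone s ∧
      ((R - C (x : ℝ)).map (algebraMap ℝ ℂ)).roots = Finset.univ.val.map fun j => (s j : ℂ) := by
    intro x
    set P := (R - C (x : ℝ)).map (algebraMap ℝ ℂ) with hP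
    have hcard : P.roots.card = N := by
      rw [IsAlgClosed.card_roots_eq_natDegree, hdegx]
    obtain ⟨s, hs, hms⟩ := exists_monotone_map_univ_eq (P.roots.map Complex.re)
      (by rw [Multiset.card_map, hcard])
    refine ⟨s, hs, ?_⟩
    have : P.roots.map (fun z => ((z.re : ℝ) : ℂ)) = P.roots := by
      conv_rhs => rw [← Multiset.map_id P.roots]
      refine Multiset.map_congr rfl fun z hz => ?_
      have hroot : aeval z R = ((x : ℝ) : ℂ) := by
        have := (mem_roots'.1 hz).2
        rw [hP, IsRoot, eval_map_algebraMap, map_sub, aeval_C, sub_eq_zero] at this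
        exact this
      exact Complex.ext rfl (by simp [hreal x x.2 z hroot])
    have hcomp : P.roots.map (fun z => ((z.re : ℝ) : ℂ)) =
        (P.roots.map Complex.re).map fun r : ℝ => (r : ℂ) := by
      rw [Multiset.map_map]
      rfl
    rw [← this, hcomp, ← hms, Multiset.map_map]
    rfl
  choose s hmono hroots using hex
  have hfac : ∀ (x : Set.Icc (0 : ℝ) 2) (y : ℝ),
      R.eval y - x = R.leadingCoeff * ∏ j, (y - s x j) := by
    intro x y
    have h := (IsAlgClosed.splits ((R - C (x : ℝ)).map (algebraMap ℝ ℂ))).eq_prod_roots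
    rw [hlcx, hroots, Multiset.map_map] at h
    have h2 := congrArg (eval (y : ℂ)) h
    rw [eval_mul, eval_C] at h2
    have h3 : eval (y : ℂ) ((R - C (x : ℝ)).map (algebraMap ℝ ℂ)) = ((R.eval y - x : ℝ) : ℂ) := by
      rw [eval_map_algebraMap, ← Complex.coe_algebraMap, aeval_algebraMap_apply]
      simp
    have h4 : eval (y : ℂ) (Multiset.map ((fun a => X - C a) ∘ fun j => ((s x j : ℝ) : ℂ))
        Finset.univ.val).prod = ((∏ j, (y - s x j) : ℝ) : ℂ) := by
      change eval (y : ℂ) (∏ j, (X - C ((s x j : ℝ) : ℂ))) = _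
      rw [eval_prod]
      push_cast
      simp
    rw [h3, h4] at h2
    exact_mod_cast h2
  have hlc : R.leadingCoeff ≠ 0 := by
    rw [Ne, leadingCoeff_eq_zero]
    rintro rfl
    simp at hdeg
    omega
  -- All the solutions lie in one compact set.
  obtain ⟨K, hK, hKs⟩ : ∃ K : Set ℝ, IsCompact K ∧ ∀ x j, s x j ∈ K := by
    have h1 : Filter.Tendsto (fun y : ℝ => ‖R.eval y‖) (Filter.cocompact ℝ) Filter.atTop :=
      R.tendsto_norm_atTop (natDegree_pos_iff_degree_pos.1 (hdeg ▸ hN))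
        (tendsto_norm_cocompact_atTop)
    have h2 := h1.eventually (Filter.eventually_gt_atTop 2)
    obtain ⟨K, hK, hK2⟩ := Filter.mem_cocompact.1 h2
    refine ⟨K, hK, fun x j => ?_⟩
    by_contra hj
    have h3 : 2 < ‖R.eval (s x j)‖ := hK2 hj
    have h4 : R.eval (s x j) = x := by
      have := hfac x (s x j)
      rw [Finset.prod_eq_zero (Finset.mem_univ j) (sub_self _), mul_zero, sub_eq_zero] at this
      exact this
    rw [h4, Real.norm_of_nonneg x.2.1] at h3
    exact absurd x.2.2 (not_le.2 h3)
  have hcont : Continuous s := by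
    rw [continuous_iff_ultrafilter]
    intro x g hg
    obtain ⟨t, -, ht⟩ := (isCompact_univ_pi fun _ : Fin N => hK).ultrafilter_le_nhds (g.map s)
      (Filter.le_principal_iff.2 (Ultrafilter.mem_map.2 (Filter.univ_mem' fun y j _ => hKs y j)))
    have ht' : Filter.Tendsto s g (nhds t) := ht
    have htj : ∀ j, Filter.Tendsto (fun y => s y j) g (nhds (t j)) := fun j =>
      (tendsto_pi_nhds.1 ht') j
    suffices t = s x by rwa [← this]
    refine eq_of_prod_sub_eq (fun i j hij => ?_) (hmono x) fun y => ?_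
    · exact le_of_tendsto_of_tendsto' (htj i) (htj j) fun y => hmono y hij
    · have l1 : Filter.Tendsto (fun x' : Set.Icc (0 : ℝ) 2 => R.eval y - (x' : ℝ)) g
          (nhds (R.eval y - x)) :=
        tendsto_const_nhds.sub ((continuous_subtype_val.tendsto x).mono_left hg)
      have l2 : Filter.Tendsto (fun x' => R.leadingCoeff * ∏ j, (y - s x' j)) g
          (nhds (R.leadingCoeff * ∏ j, (y - t j))) :=
        (tendsto_finsetProd _ fun j _ => tendsto_const_nhds.sub (htj j)).const_mul _
      have l3 := tendsto_nhds_unique (l1.congr fun x' => hfac x' y) l2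
      exact mul_left_cancel₀ hlc (l3.symm.trans (hfac x y))
  refine ⟨fun j x => s (Set.projIcc 0 2 (by norm_num) x) j, fun j => ?_, fun x hx => ?_⟩
  · exact (((continuous_apply j).comp hcont).comp continuous_projIcc).continuousOn
  · have := hroots ⟨x, hx⟩
    simpa only [Set.projIcc_of_mem _ hx] using this

theorem amoDecimation_exists_isInverseBranches {p : ℝ} (hp : p ∈ Set.Ioo (0 : ℝ) 1) (β : ℝ)
    (n k : ℕ) : ∃ S : Fin (3 ^ n) → ℝ → ℝ, IsInverseBranches (amoDecimation p β n k) S :=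
  exists_isInverseBranches (amoDecimation_natDegree hp β n k) (by positivity)
    fun _ hx _ hz => im_eq_zero_of_amoDecimation hp β n k hx hz

/-! ### Elementary properties of the branches -/

theorem IsInverseBranches.natDegree {R : ℝ[X]} {N : ℕ} {S : Fin N → ℝ → ℝ}
    (hS : IsInverseBranches R S) : R.natDegree = N := by
  have h := congrArg Multiset.card (hS.2 0 (by norm_num))
  rw [IsAlgClosed.card_roots_eq_natDegree, natDegree_map, natDegree_sub_C] at h
  simpa using h

theorem IsInverseBranches.map_sub_C_ne_zero {R : ℝ[X]} {N : ℕ} {S : Fin N → ℝ → ℝ}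
    (hS : IsInverseBranches R S) (hN : 0 < N) (x : ℝ) :
    (R - C x).map (algebraMap ℝ ℂ) ≠ 0 := by
  refine ne_zero_of_natDegree_gt (n := 0) ?_
  rw [natDegree_map, natDegree_sub_C, hS.natDegree]
  exact hN

theorem IsInverseBranches.eval_eq_iff {R : ℝ[X]} {N : ℕ} {S : Fin N → ℝ → ℝ}
    (hS : IsInverseBranches R S) (hN : 0 < N) {x : ℝ} (hx : x ∈ Set.Icc (0 : ℝ) 2) (y : ℝ) :
    R.eval y = x ↔ ∃ j, S j x = y := by
  have h1 : (y : ℂ) ∈ ((R - C x).map (algebraMap ℝ ℂ)).roots ↔ R.eval y = x := by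
    rw [mem_roots (hS.map_sub_C_ne_zero hN x), IsRoot, eval_map_algebraMap,
      ← Complex.coe_algebraMap, aeval_algebraMap_apply, Complex.coe_algebraMap,
      Complex.ofReal_eq_zero]
    simp [sub_eq_zero]
  rw [← h1, hS.2 x hx]
  simp

theorem IsInverseBranches.eval_apply {R : ℝ[X]} {N : ℕ} {S : Fin N → ℝ → ℝ}
    (hS : IsInverseBranches R S) (j : Fin N) {x : ℝ} (hx : x ∈ Set.Icc (0 : ℝ) 2) :
    R.eval (S j x) = x :=
  (hS.eval_eq_iff (Fin.pos j) hx _).2 ⟨j, rfl⟩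

/-- A point of `[0, 2]` where two branches meet is the value of `R` at a critical point. -/
theorem IsInverseBranches.derivative_eval_eq_zero {R : ℝ[X]} {N : ℕ} {S : Fin N → ℝ → ℝ}
    (hS : IsInverseBranches R S) {i j : Fin N} (hij : i ≠ j) {x : ℝ}
    (hx : x ∈ Set.Icc (0 : ℝ) 2) (h : S i x = S j x) : R.derivative.eval (S i x) = 0 := by
  have hne := hS.map_sub_C_ne_zero (Fin.pos i) x
  have hcount : 1 < ((R - C x).map (algebraMap ℝ ℂ)).rootMultiplicity (S i x : ℂ) := by
    rw [← count_roots, hS.2 x hx, Multiset.count_map]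
    change 1 < (Finset.univ.filter fun a => (S i x : ℂ) = S a x).card
    rw [Finset.one_lt_card]
    exact ⟨i, by simp, j, by simp [h], hij⟩
  have h1 := ((one_lt_rootMultiplicity_iff_isRoot hne).1 hcount).2
  rw [derivative_map, IsRoot, eval_map_algebraMap, ← Complex.coe_algebraMap,
    aeval_algebraMap_apply, Complex.coe_algebraMap, Complex.ofReal_eq_zero] at h1
  simpa using h1

theorem IsInverseBranches.finite_setOf_eq {R : ℝ[X]} {N : ℕ} {S : Fin N → ℝ → ℝ}
    (hS : IsInverseBranches R S) {i j : Fin N} (hij : i ≠ j) :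
    {x | x ∈ Set.Icc (0 : ℝ) 2 ∧ S i x = S j x}.Finite := by
  have hd : R.derivative ≠ 0 := by
    intro h
    have := derivative_eq_zero.1 h
    rw [hS.natDegree] at this
    exact (Fin.pos i).ne' this
  refine (R.derivative.rootSet_finite ℝ |>.image fun y => R.eval y).subset ?_
  rintro x ⟨hx, h⟩
  refine ⟨S i x, ?_, hS.eval_apply i hx⟩
  rw [mem_rootSet]
  exact ⟨hd, by simpa using hS.derivative_eval_eq_zero hij hx h⟩

/-! ### Invariant measures of averaging operators -/

section Averaging

variable {X : Type*} [TopologicalSpace X] {N : ℕ}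

/-- The averaging operator `f ↦ N⁻¹ ∑ᵢ f ∘ Sᵢ` on continuous functions. -/
noncomputable def averaging (S : Fin N → C(X, X)) (f : C(X, ℝ)) : C(X, ℝ) :=
  (N : ℝ)⁻¹ • ∑ i, f.comp (S i)

theorem averaging_apply (S : Fin N → C(X, X)) (f : C(X, ℝ)) (x : X) :
    averaging S f x = (N : ℝ)⁻¹ * ∑ i, f (S i x) := by
  simp [averaging]

theorem averaging_add (S : Fin N → C(X, X)) (f g : C(X, ℝ)) :
    averaging S (f + g) = averaging S f + averaging S g := by
  ext x
  simp [averaging_apply, Finset.sum_add_distrib, mul_add]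

theorem averaging_smul (S : Fin N → C(X, X)) (c : ℝ) (f : C(X, ℝ)) :
    averaging S (c • f) = c • averaging S f := by
  ext x
  simp only [averaging_apply, ContinuousMap.smul_apply, smul_eq_mul, ← Finset.mul_sum]
  ring

theorem averaging_one (hN : 0 < N) (S : Fin N → C(X, X)) : averaging S 1 = 1 := by
  ext x
  have : (N : ℝ) ≠ 0 := by exact_mod_cast hN.ne'
  simp [averaging_apply, this]

theorem averaging_mono (S : Fin N → C(X, X)) {f g : C(X, ℝ)} (h : f ≤ g) :
    averaging S f ≤ averaging S g := fun x => by
  change averaging S f x ≤ averaging S g x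
  rw [averaging_apply, averaging_apply]
  exact mul_le_mul_of_nonneg_left (Finset.sum_le_sum fun i _ => h _) (by positivity)

/-- The Cesàro means of the orbit of `f` under the averaging operator, evaluated at `x`. -/
noncomputable def cesaro (S : Fin N → C(X, X)) (x : X) (m : ℕ) (f : C(X, ℝ)) : ℝ :=
  ((m : ℝ) + 1)⁻¹ * ∑ k ∈ Finset.range (m + 1), ((averaging S)^[k] f) x

theorem iterate_averaging_mono (S : Fin N → C(X, X)) (k : ℕ) {f g : C(X, ℝ)} (h : f ≤ g) :
    (averaging S)^[k] f ≤ (averaging S)^[k] g :=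
  Monotone.iterate (f := averaging S) (fun _ _ h => averaging_mono S h) k h

theorem iterate_averaging_add (S : Fin N → C(X, X)) (k : ℕ) (f g : C(X, ℝ)) :
    (averaging S)^[k] (f + g) = (averaging S)^[k] f + (averaging S)^[k] g := by
  induction k generalizing f g with
  | zero => rfl
  | succ k ih => simp only [Function.iterate_succ_apply, averaging_add, ih]

theorem iterate_averaging_smul (S : Fin N → C(X, X)) (k : ℕ) (c : ℝ) (f : C(X, ℝ)) :
    (averaging S)^[k] (c • f) = c • (averaging S)^[k] f := by
  induction k generalizing f with
  | zero => rfl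
  | succ k ih => simp only [Function.iterate_succ_apply, averaging_smul, ih]

theorem iterate_averaging_const (hN : 0 < N) (S : Fin N → C(X, X)) (k : ℕ) (c : ℝ) :
    (averaging S)^[k] (c • (1 : C(X, ℝ))) = c • (1 : C(X, ℝ)) := by
  rw [iterate_averaging_smul, Function.iterate_fixed (averaging_one hN S)]

theorem cesaro_mono (S : Fin N → C(X, X)) (x : X) (m : ℕ) {f g : C(X, ℝ)} (h : f ≤ g) :
    cesaro S x m f ≤ cesaro S x m g :=
  mul_le_mul_of_nonneg_left (Finset.sum_le_sum fun k _ => iterate_averaging_mono S k h x)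
    (by positivity)

theorem cesaro_add (S : Fin N → C(X, X)) (x : X) (m : ℕ) (f g : C(X, ℝ)) :
    cesaro S x m (f + g) = cesaro S x m f + cesaro S x m g := by
  simp [cesaro, iterate_averaging_add, Finset.sum_add_distrib, mul_add]

theorem cesaro_smul (S : Fin N → C(X, X)) (x : X) (m : ℕ) (c : ℝ) (f : C(X, ℝ)) :
    cesaro S x m (c • f) = c * cesaro S x m f := by
  simp only [cesaro, iterate_averaging_smul, ContinuousMap.smul_apply, smul_eq_mul,
    ← Finset.mul_sum]
  ring

theorem cesaro_const (hN : 0 < N) (S : Fin N → C(X, X)) (x : X) (m : ℕ) (c : ℝ) :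
    cesaro S x m (c • (1 : C(X, ℝ))) = c := by
  have : (m : ℝ) + 1 ≠ 0 := by positivity
  simp [cesaro, iterate_averaging_const hN]
  field_simp

theorem cesaro_averaging (S : Fin N → C(X, X)) (x : X) (m : ℕ) (f : C(X, ℝ)) :
    cesaro S x m (averaging S f) =
      cesaro S x m f + ((m : ℝ) + 1)⁻¹ * (((averaging S)^[m + 1] f) x - f x) := by
  simp only [cesaro, ← Function.iterate_succ_apply]
  rw [← mul_add]
  congr 1
  have h := Finset.sum_range_succ' (fun k => ((averaging S)^[k] f) x) (m + 1)
  rw [Finset.sum_range_succ] at h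
  simp only [Function.iterate_zero, id] at h
  linarith

theorem le_norm_smul_one [CompactSpace X] (f : C(X, ℝ)) : f ≤ ‖f‖ • (1 : C(X, ℝ)) := fun x => by
  simpa using (le_abs_self _).trans (f.norm_coe_le_norm x)

theorem neg_norm_smul_one_le [CompactSpace X] (f : C(X, ℝ)) :
    (-‖f‖) • (1 : C(X, ℝ)) ≤ f := fun x => by
  simpa using neg_le_of_abs_le (f.norm_coe_le_norm x)

theorem cesaro_mem_Icc [CompactSpace X] (hN : 0 < N) (S : Fin N → C(X, X)) (x : X) (m : ℕ)
    (f : C(X, ℝ)) : cesaro S x m f ∈ Set.Icc (-‖f‖) ‖f‖ := by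
  have h1 := cesaro_mono S x m (le_norm_smul_one f)
  have h2 := cesaro_mono S x m (neg_norm_smul_one_le f)
  rw [cesaro_const hN] at h1 h2
  exact ⟨h2, h1⟩

theorem abs_iterate_averaging_le [CompactSpace X] (hN : 0 < N) (S : Fin N → C(X, X)) (x : X)
    (k : ℕ) (f : C(X, ℝ)) : |((averaging S)^[k] f) x| ≤ ‖f‖ := by
  have h1 : ((averaging S)^[k] f) x ≤ ((averaging S)^[k] (‖f‖ • (1 : C(X, ℝ)))) x :=
    iterate_averaging_mono S k (le_norm_smul_one f) x
  have h2 : ((averaging S)^[k] ((-‖f‖) • (1 : C(X, ℝ)))) x ≤ ((averaging S)^[k] f) x :=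
    iterate_averaging_mono S k (neg_norm_smul_one_le f) x
  rw [iterate_averaging_const hN] at h1 h2
  simp only [ContinuousMap.smul_apply, ContinuousMap.one_apply, smul_eq_mul, mul_one] at h1 h2
  exact abs_le.2 ⟨h2, h1⟩

/-- Krylov–Bogoliubov: finitely many continuous self-maps of a nonempty compact space have a
common stationary probability measure, `μ = N⁻¹ ∑ᵢ (Sᵢ)₊ μ`. It represents the limit of the Cesàro
means along a non-principal ultrafilter. -/
theorem exists_stationary_measure [CompactSpace X] [TopologicalSpace.MetrizableSpace X]
    [MeasurableSpace X] [BorelSpace X] [Nonempty X] (hN : 0 < N) (S : Fin N → C(X, X)) :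
    ∃ μ : Measure X, IsProbabilityMeasure μ ∧
      ((N : ENNReal)⁻¹ • ∑ i, μ.map (S i)) = μ := by
  obtain ⟨x⟩ := ‹Nonempty X›
  let g : Ultrafilter ℕ := Filter.hyperfilter ℕ
  have hlim : ∀ f : C(X, ℝ), ∃ L : ℝ, Filter.Tendsto (fun m => cesaro S x m f) g (nhds L) := by
    intro f
    obtain ⟨L, -, hL⟩ := (isCompact_Icc (a := -‖f‖) (b := ‖f‖)).ultrafilter_le_nhds
      (g.map fun m => cesaro S x m f)
      (Filter.le_principal_iff.2 (Ultrafilter.mem_map.2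
        (Filter.univ_mem' fun m => cesaro_mem_Icc hN S x m f)))
    exact ⟨L, hL⟩
  choose L hL using hlim
  have hgtop : (g : Filter ℕ) ≤ Filter.atTop := by
    rw [← Nat.cofinite_eq_atTop]
    exact Filter.hyperfilter_le_cofinite
  have hLavg : ∀ f, L (averaging S f) = L f := by
    intro f
    refine tendsto_nhds_unique (hL (averaging S f)) ?_
    simp only [cesaro_averaging]
    have h0 : Filter.Tendsto (fun m : ℕ => ((m : ℝ) + 1)⁻¹ *
        (((averaging S)^[m + 1] f) x - f x)) g (nhds 0) := by
      refine Filter.Tendsto.mono_left ?_ hgtop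
      have h1 : Filter.Tendsto (fun m : ℕ => ((m : ℝ) + 1)⁻¹) Filter.atTop (nhds 0) := by
        simpa only [one_div] using tendsto_one_div_add_atTop_nhds_zero_nat (𝕜 := ℝ)
      refine h1.zero_mul_isBoundedUnder_le ?_
      refine Filter.isBoundedUnder_of ⟨‖f‖ + ‖f‖, fun m => ?_⟩
      exact (norm_sub_le _ _).trans (add_le_add (abs_iterate_averaging_le hN S x _ f)
        (f.norm_coe_le_norm x))
    simpa using (hL f).add h0
  let Λ : CompactlySupportedContinuousMap X ℝ →ₚ[ℝ] ℝ :=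
    { toFun := fun f => L f.toContinuousMap
      map_add' := fun f f' => tendsto_nhds_unique (hL _) (by
        have := (hL f.toContinuousMap).add (hL f'.toContinuousMap)
        simp only [← cesaro_add] at this
        exact this)
      map_smul' := fun c f => tendsto_nhds_unique (hL _) (by
        have := (hL f.toContinuousMap).const_mul c
        simp only [← cesaro_smul] at this
        exact this)
      monotone' := fun f f' h => le_of_tendsto_of_tendsto' (hL _) (hL _)
        fun m => cesaro_mono S x m h }
  have hint : ∀ f : C(X, ℝ), ∫ y, f y ∂(RealRMK.rieszMeasure Λ) = L f := fun f =>
    RealRMK.integral_rieszMeasure Λ ⟨f, HasCompactSupport.of_compactSpace _⟩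
  set μ := RealRMK.rieszMeasure Λ with hμ
  have hprob : IsProbabilityMeasure μ := by
    have h1 := hint 1
    have h2 : L 1 = 1 := by
      refine tendsto_nhds_unique (hL 1) ?_
      have := fun m => cesaro_const hN S x m 1
      simp only [one_smul] at this
      simp only [this]
      exact tendsto_const_nhds
    rw [h2] at h1
    simp only [ContinuousMap.one_apply, integral_const, smul_eq_mul, mul_one] at h1
    refine ⟨?_⟩
    rw [← ENNReal.ofReal_toReal (measure_ne_top μ _), ← Measure.real, h1, ENNReal.ofReal_one]
  have hN' : (N : ENNReal)⁻¹ ≠ ⊤ := by simpa using hN.ne'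
  have : IsFiniteMeasure ((N : ENNReal)⁻¹ • ∑ i, μ.map (S i)) :=
    Measure.smul_finite _ hN'
  refine ⟨μ, hprob, ext_of_forall_integral_eq_of_IsFiniteMeasure fun f => ?_⟩
  have hmap : ∀ i, ∫ y, f y ∂(μ.map (S i)) = ∫ y, f (S i y) ∂μ := fun i =>
    integral_map (S i).continuous.measurable.aemeasurable
      f.continuous.measurable.aestronglyMeasurable
  rw [integral_smul_measure, integral_finsetSum_measure (fun i _ => f.integrable _),
    ENNReal.toReal_inv, ENNReal.toReal_natCast]
  simp only [hmap]
  have e := hint (averaging S f.toContinuousMap)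
  rw [hLavg, ← hint] at e
  simp only [averaging_apply] at e
  rw [integral_const_mul, integral_finsetSum] at e
  · exact e
  · intro i _
    exact (f.compContinuous (S i)).integrable μ

end Averaging

/-! ### The cubic decimation polynomial of the Laplacian and its Julia set -/

theorem lapDecimation_eval (p z : ℝ) :
    (lapDecimation p).eval z = z * (z + (p - 2)) * (z - (p + 1)) / (p * (1 - p)) := by
  simp only [lapDecimation, eval_mul, eval_sub, eval_add, eval_C, eval_X]
  ring

theorem lapDecimation_eval_le {p : ℝ} (hp : p ∈ Set.Ioo (0 : ℝ) 1) {z : ℝ} (hz : z ≤ 0) :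
    (lapDecimation p).eval z ≤ 3 * z := by
  have h0 := hp.1
  have h1 : 0 < 1 - p := by linarith [hp.2]
  rw [lapDecimation_eval, div_le_iff₀ (mul_pos h0 h1)]
  nlinarith [mul_pos h0 h1, mul_nonneg (neg_nonneg.2 hz) (neg_nonneg.2 hz),
    mul_nonneg (mul_nonneg (neg_nonneg.2 hz) (neg_nonneg.2 hz)) (neg_nonneg.2 hz),
    sq_nonneg (2 * p - 1), mul_nonneg (neg_nonneg.2 hz) (sq_nonneg (2 * p - 1))]

theorem two_lt_lapDecimation_eval {p : ℝ} (hp : p ∈ Set.Ioo (0 : ℝ) 1) {z : ℝ} (hz : 2 < z) :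
    2 < (lapDecimation p).eval z := by
  have h0 := hp.1
  have h1 : 0 < 1 - p := by linarith [hp.2]
  rw [lapDecimation_eval, lt_div_iff₀ (mul_pos h0 h1)]
  have h : 0 < (z - 2) * (z - p) * (z - (1 - p)) :=
    mul_pos (mul_pos (by linarith) (by linarith [hp.2])) (by linarith)
  nlinarith

theorem mem_Icc_of_lapDecimation_eval {p : ℝ} (hp : p ∈ Set.Ioo (0 : ℝ) 1) {z : ℝ}
    (hz : (lapDecimation p).eval z ∈ Set.Icc (0 : ℝ) 2) : z ∈ Set.Icc (0 : ℝ) 2 := by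
  refine ⟨?_, ?_⟩
  · by_contra h
    have := lapDecimation_eval_le hp (not_le.1 h).le
    linarith [hz.1, not_le.1 h]
  · by_contra h
    exact absurd hz.2 (not_le.2 (two_lt_lapDecimation_eval hp (not_le.1 h)))

theorem lapDecimation_natDegree {p : ℝ} (hp : p ∈ Set.Ioo (0 : ℝ) 1) :
    (lapDecimation p).natDegree = 3 := by
  rw [lapDecimation_eq_amoDecimation hp, amoDecimation_natDegree hp, pow_one]

/-- The Julia set of a non-constant polynomial is fully invariant, because polynomial maps are
continuous and open. -/
theorem eval_mem_juliaSet_iff {P : ℂ[X]} (hP : P.natDegree ≠ 0) (z : ℂ) :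
    P.eval z ∈ juliaSet P ↔ z ∈ juliaSet P := by
  have hq := P.isOpenQuotientMap_eval hP
  have h := hq.isOpenMap.preimage_frontier_eq_frontier_preimage hq.continuous
    {z : ℂ | Bornology.IsBounded (Set.range fun m : ℕ => (fun w => P.eval w)^[m] z)}
  have hK : (fun w => P.eval w) ⁻¹'
      {z : ℂ | Bornology.IsBounded (Set.range fun m : ℕ => (fun w => P.eval w)^[m] z)} =
      {z : ℂ | Bornology.IsBounded (Set.range fun m : ℕ => (fun w => P.eval w)^[m] z)} := by
    ext w
    have hr : (Set.range fun m : ℕ => (fun w => P.eval w)^[m] w) =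
        insert w (Set.range fun m : ℕ => (fun w => P.eval w)^[m] (P.eval w)) := by
      ext y
      constructor
      · rintro ⟨m, rfl⟩
        cases m with
        | zero => exact Or.inl rfl
        | succ m => exact Or.inr ⟨m, rfl⟩
      · rintro (rfl | ⟨m, rfl⟩)
        · exact ⟨0, rfl⟩
        · exact ⟨m + 1, rfl⟩
    simp only [Set.mem_preimage, Set.mem_ofPred_eq]
    rw [hr, Bornology.isBounded_insert]
  rw [hK] at h
  exact Set.ext_iff.1 h z

theorem iterate_eval_map_ofReal (R : ℝ[X]) (m : ℕ) (x : ℝ) :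
    (fun w => (R.map (algebraMap ℝ ℂ)).eval w)^[m] (x : ℂ) =
      (((fun y => R.eval y)^[m] x : ℝ) : ℂ) := by
  induction m generalizing x with
  | zero => rfl
  | succ m ih =>
    have h : (R.map (algebraMap ℝ ℂ)).eval (x : ℂ) = ((R.eval x : ℝ) : ℂ) := by
      rw [eval_map_algebraMap, ← Complex.coe_algebraMap, aeval_algebraMap_apply]
      simp
    rw [Function.iterate_succ_apply, Function.iterate_succ_apply, h, ih]

/-- The fixed point `0` lies in the Julia set, since all negative numbers escape to `-∞`. -/
theorem zero_mem_juliaSet_lapDecimation {p : ℝ} (hp : p ∈ Set.Ioo (0 : ℝ) 1) :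
    (0 : ℂ) ∈ juliaSet ((lapDecimation p).map (algebraMap ℝ ℂ)) := by
  have hfix : (lapDecimation p).eval 0 = 0 := by rw [lapDecimation_eval]; simp
  have hesc : ∀ x : ℝ, x < 0 → ¬ Bornology.IsBounded (Set.range fun m : ℕ =>
      (fun w => ((lapDecimation p).map (algebraMap ℝ ℂ)).eval w)^[m] (x : ℂ)) := by
    intro x hx hb
    have hgrow : ∀ m : ℕ, (fun y => (lapDecimation p).eval y)^[m] x ≤ 3 ^ m * x := by
      intro m
      induction m with
      | zero => simp
      | succ m ih =>
        rw [Function.iterate_succ_apply']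
        have hneg : 3 ^ m * x ≤ 0 := mul_nonpos_of_nonneg_of_nonpos (by positivity) hx.le
        refine (lapDecimation_eval_le hp (ih.trans hneg)).trans ?_
        rw [pow_succ]
        linarith
    obtain ⟨B, hB⟩ := hb.exists_norm_le
    obtain ⟨m, hm⟩ := pow_unbounded_of_one_lt (B / -x) (by norm_num : (1 : ℝ) < 3)
    have h1 := hB _ ⟨m, rfl⟩
    simp only [iterate_eval_map_ofReal] at h1
    rw [Complex.norm_real, Real.norm_eq_abs] at h1
    have h2 := hgrow m
    have h3 := neg_le_of_abs_le h1
    rw [div_lt_iff₀ (by linarith)] at hm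
    linarith
  rw [juliaSet, frontier_eq_closure_inter_closure]
  refine ⟨subset_closure ?_, ?_⟩
  · have : (Set.range fun m : ℕ => (fun w => ((lapDecimation p).map (algebraMap ℝ ℂ)).eval w)^[m]
        (0 : ℂ)) ⊆ {0} := by
      rintro _ ⟨m, rfl⟩
      have := iterate_eval_map_ofReal (lapDecimation p) m 0
      rw [Function.iterate_fixed (f := fun y => (lapDecimation p).eval y) hfix] at this
      simpa using this
    exact Bornology.isBounded_singleton.subset this
  · rw [mem_closure_iff_seq_limit]
    refine ⟨fun m : ℕ => ((-(1 / ((m : ℝ) + 1)) : ℝ) : ℂ), fun m => hesc _ ?_, ?_⟩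
    · rw [neg_lt_zero]
      positivity
    · have h := (tendsto_one_div_add_atTop_nhds_zero_nat (𝕜 := ℝ)).neg
      rw [neg_zero] at h
      exact (Complex.continuous_ofReal.tendsto' 0 0 Complex.ofReal_zero).comp h

/-- The three branches of the inverse never all coincide, since the cubic polynomial has no triple
values: `3 - 2y` is the other solution of `R(z) = R(y)` when `y` is critical. -/
theorem exists_branch_ne {p : ℝ} (hp : p ∈ Set.Ioo (0 : ℝ) 1) {S : Fin 3 → ℝ → ℝ}
    (hS : IsInverseBranches (lapDecimation p) S) {x : ℝ} (hx : x ∈ Set.Icc (0 : ℝ) 2) (y : ℝ) :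
    ∃ i, S i x ≠ y := by
  by_contra! h
  have h0 := hp.1
  have h1 : 0 < 1 - p := by linarith [hp.2]
  have hpq : p * (1 - p) ≠ 0 := (mul_pos h0 h1).ne'
  have hd := hS.derivative_eval_eq_zero (i := 0) (j := 1) (by decide) hx (by rw [h, h])
  have hy := hS.eval_apply 0 hx
  rw [h] at hd hy
  have hd' : 3 * y ^ 2 - 6 * y + 2 + p * (1 - p) = 0 := by
    simp only [lapDecimation, derivative_mul, derivative_C, derivative_X, derivative_add,
      derivative_sub, eval_mul, eval_add, eval_sub, eval_C, eval_X, eval_zero, eval_one] at hd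
    field_simp at hd
    linarith
  have hother : (lapDecimation p).eval (3 - 2 * y) = x := by
    rw [← hy, lapDecimation_eval, lapDecimation_eval]
    congr 1
    linear_combination (3 - 3 * y) * hd'
  obtain ⟨j, hj⟩ := (hS.eval_eq_iff (by norm_num) hx _).1 hother
  rw [h] at hj
  have hy1 : y = 1 := by linarith
  rw [hy1] at hd'
  nlinarith [sq_nonneg (2 * p - 1)]

/-! ### Existence of the balanced measure -/

/-- A stationary measure of three branches which never all coincide has no atoms: the supremum `c`
of the masses of the points satisfies `c ≤ 2c/3`. -/
theorem measure_singleton_eq_zero_of_stationary {R : ℝ[X]} {S : Fin 3 → ℝ → ℝ}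
    (hS : IsInverseBranches R S)
    (hne : ∀ x ∈ Set.Icc (0 : ℝ) 2, ∀ y, ∃ i, S i x ≠ y) {ν : Measure ℝ} [IsProbabilityMeasure ν]
    (hsupp : ∀ᵐ x ∂ν, x ∈ Set.Icc (0 : ℝ) 2)
    (hν : ∀ B, MeasurableSet B → ν B = 3⁻¹ * ∑ i, ν (S i ⁻¹' B)) (y : ℝ) : ν {y} = 0 := by
  set c : ENNReal := ⨆ y : ℝ, ν {y} with hc
  have hctop : c ≠ ⊤ := ne_top_of_le_ne_top ENNReal.one_ne_top (iSup_le fun y => prob_le_one)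
  have hle : ∀ y : ℝ, ∀ i, ν (S i ⁻¹' {y}) ≤ c := by
    intro y i
    refine le_trans ?_ (le_iSup (fun y : ℝ => ν {y}) (R.eval y))
    refine measure_mono_ae ?_
    filter_upwards [hsupp] with x hx hxy
    change S i x = y at hxy
    change x = R.eval y
    rw [← hxy, hS.eval_apply i hx]
  have hzero : ∀ y : ℝ, ∃ i, ν (S i ⁻¹' {y}) = 0 := by
    intro y
    by_cases hy : R.eval y ∈ Set.Icc (0 : ℝ) 2
    · obtain ⟨i, hi⟩ := hne _ hy y
      refine ⟨i, ?_⟩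
      rw [measure_eq_zero_iff_ae_notMem]
      filter_upwards [hsupp] with x hx hxy
      change S i x = y at hxy
      have := hS.eval_apply i hx
      rw [hxy] at this
      rw [this] at hi
      exact hi hxy
    · refine ⟨0, ?_⟩
      rw [measure_eq_zero_iff_ae_notMem]
      filter_upwards [hsupp] with x hx hxy
      change S 0 x = y at hxy
      have := hS.eval_apply 0 hx
      rw [hxy] at this
      rw [this] at hy
      exact hy hx
  have hbound : c ≤ 3⁻¹ * (2 * c) := by
    refine iSup_le fun y => ?_
    rw [hν _ (measurableSet_singleton y)]
    gcongr
    obtain ⟨i, hi⟩ := hzero y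
    rw [← Finset.add_sum_erase _ _ (Finset.mem_univ i), hi, zero_add]
    refine (Finset.sum_le_card_nsmul _ _ c fun j _ => hle y j).trans ?_
    rw [Finset.card_erase_of_mem (Finset.mem_univ i)]
    simp
  have hc0 : c = 0 := by
    have h : 3 * c ≤ 2 * c := by
      calc 3 * c ≤ 3 * (3⁻¹ * (2 * c)) := by gcongr
        _ = 2 * c := by
          rw [← mul_assoc, ENNReal.mul_inv_cancel (by norm_num) (by norm_num), one_mul]
    have h2 : c + 2 * c ≤ 0 + 2 * c := by
      calc c + 2 * c = 3 * c := by ring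
        _ ≤ _ := by rwa [zero_add]
    exact nonpos_iff_eq_zero.1 ((ENNReal.add_le_add_iff_right (by finiteness)).1 h2)
  exact nonpos_iff_eq_zero.1 ((le_iSup (fun y : ℝ => ν {y}) y).trans hc0.le)

/-- A stationary measure without atoms of the inverse branches of a polynomial is balanced: up to
null sets, `R(A)` is the disjoint union of the sets `Sᵢ⁻¹(A)` if `R` is injective on `A`. -/
theorem measure_image_eq_of_stationary {R : ℝ[X]} {S : Fin 3 → ℝ → ℝ} (hS : IsInverseBranches R S)
    (hSm : ∀ i, Measurable (S i)) {ν : Measure ℝ} [NullSingletonClass ν]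
    (hsupp : ∀ᵐ x ∂ν, x ∈ Set.Icc (0 : ℝ) 2)
    (hν : ∀ B, MeasurableSet B → ν B = 3⁻¹ * ∑ i, ν (S i ⁻¹' B)) {A : Set ℝ}
    (hA : MeasurableSet A) (hinj : Set.InjOn (fun x => R.eval x) A) :
    ν ((fun x => R.eval x) '' A) = 3 * ν A := by
  have h1 : ν ((fun x => R.eval x) '' A) = ν (⋃ i, S i ⁻¹' A) := by
    refine measure_congr ?_
    filter_upwards [hsupp] with x hx
    refine propext ⟨?_, ?_⟩
    · rintro ⟨y, hy, hxy⟩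
      obtain ⟨i, hi⟩ := (hS.eval_eq_iff (by norm_num) hx y).1 hxy
      exact Set.mem_iUnion.2 ⟨i, by rw [Set.mem_preimage, hi]; exact hy⟩
    · intro h
      obtain ⟨i, hi⟩ := Set.mem_iUnion.1 h
      exact ⟨S i x, hi, hS.eval_apply i hx⟩
  have h2 : Pairwise (Function.onFun (AEDisjoint ν) fun i => S i ⁻¹' A) := by
    intro i j hij
    have h0 : ν {x | x ∈ Set.Icc (0 : ℝ) 2 ∧ S i x = S j x} = 0 :=
      (hS.finite_setOf_eq hij).measure_zero ν
    refine measure_mono_null_ae ?_ h0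
    filter_upwards [hsupp] with x hx hxA
    refine ⟨hx, hinj hxA.1 hxA.2 ?_⟩
    change R.eval (S i x) = R.eval (S j x)
    rw [hS.eval_apply i hx, hS.eval_apply j hx]
  rw [h1, measure_iUnion₀ h2 fun i => (hSm i hA).nullMeasurableSet, tsum_fintype, hν A hA,
    ← mul_assoc, ENNReal.mul_inv_cancel (by norm_num) (by norm_num), one_mul]

/-- The stationary measure of the three inverse branches, on the compact backward invariant set of
points of `[0, 2]` in the Julia set, is a balanced measure. -/
theorem exists_isBalancedMeasure {p : ℝ} (hp : p ∈ Set.Ioo (0 : ℝ) 1) :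
    ∃ ν : Measure ℝ, IsBalancedMeasure (lapDecimation p) ν := by
  have hdeg := lapDecimation_natDegree hp
  obtain ⟨S₀, hS₀⟩ := exists_isInverseBranches hdeg (by norm_num) fun x hx z hz => by
    rw [lapDecimation_eq_amoDecimation hp] at hz
    exact im_eq_zero_of_amoDecimation hp 1 1 0 hx hz
  -- The branches are made continuous on the whole line.
  obtain ⟨S, hS, hSc⟩ : ∃ S : Fin 3 → ℝ → ℝ, IsInverseBranches (lapDecimation p) S ∧
      ∀ i, Continuous (S i) := by
    have hc : ∀ i, Continuous fun x : ℝ => S₀ i (Set.projIcc (0 : ℝ) 2 (by norm_num) x) := fun i =>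
      (continuousOn_iff_continuous_domRestrict.1 (hS₀.1 i)).comp continuous_projIcc
    refine ⟨fun i x => S₀ i (Set.projIcc (0 : ℝ) 2 (by norm_num) x), ⟨fun i => (hc i).continuousOn,
      fun x hx => ?_⟩, hc⟩
    simp only [Set.projIcc_of_mem _ hx]
    exact hS₀.2 x hx
  set P := (lapDecimation p).map (algebraMap ℝ ℂ) with hP
  have hPdeg : P.natDegree ≠ 0 := by rw [hP, natDegree_map, hdeg]; norm_num
  have hJclosed : IsClosed {x : ℝ | (x : ℂ) ∈ juliaSet P} :=
    isClosed_frontier.preimage Complex.continuous_ofReal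
  set K : Set ℝ := Set.Icc 0 2 ∩ {x : ℝ | (x : ℂ) ∈ juliaSet P} with hK
  have hKc : IsCompact K := isCompact_Icc.inter_right hJclosed
  have hmap : ∀ i, ∀ x ∈ K, S i x ∈ K := by
    intro i x hx
    have h := hS.eval_apply i hx.1
    refine ⟨mem_Icc_of_lapDecimation_eval hp (by rw [h]; exact hx.1), ?_⟩
    change ((S i x : ℝ) : ℂ) ∈ juliaSet P
    rw [← eval_mem_juliaSet_iff hPdeg]
    have := iterate_eval_map_ofReal (lapDecimation p) 1 (S i x)
    simp only [Function.iterate_one] at this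
    rw [hP, this, h]
    exact hx.2
  have : CompactSpace K := isCompact_iff_compactSpace.1 hKc
  have : Nonempty K := ⟨⟨0, by norm_num, by
    simpa using zero_mem_juliaSet_lapDecimation hp⟩⟩
  obtain ⟨μ, hμ, hstat⟩ := exists_stationary_measure (N := 3) (by norm_num) fun i =>
    (⟨fun x : K => ⟨S i x, hmap i x x.2⟩, by
      exact ((hSc i).comp continuous_subtype_val).subtype_mk _⟩ : C(K, K))
  set ν := μ.map (Subtype.val : K → ℝ) with hνdef
  have hval : Measurable (Subtype.val : K → ℝ) := measurable_subtype_coe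
  have hprob : IsProbabilityMeasure ν := Measure.isProbabilityMeasure_map hval.aemeasurable
  have hνK : ∀ᵐ x ∂ν, x ∈ K := by
    refine (ae_map_iff (p := fun x => x ∈ K) hval.aemeasurable hKc.measurableSet).2 ?_
    exact Filter.Eventually.of_forall fun x => x.2
  have hsupp : ∀ᵐ x ∂ν, x ∈ Set.Icc (0 : ℝ) 2 := hνK.mono fun x hx => hx.1
  have hν : ∀ B, MeasurableSet B → ν B = 3⁻¹ * ∑ i, ν (S i ⁻¹' B) := by
    intro B hB
    rw [hνdef, Measure.map_apply hval hB]
    conv_lhs => rw [← hstat]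
    rw [Measure.smul_apply, Measure.finsetSum_apply, smul_eq_mul]
    congr 1
    refine Finset.sum_congr rfl fun i _ => ?_
    rw [Measure.map_apply (ContinuousMap.continuous _).measurable (hval hB),
      Measure.map_apply hval ((hSc i).measurable hB)]
    rfl
  have hatom := measure_singleton_eq_zero_of_stationary hS
    (fun x hx y => exists_branch_ne hp hS hx y) hsupp hν
  have : NullSingletonClass ν := ⟨hatom⟩
  refine ⟨ν, hprob, hνK.mono fun x hx => hx.2, ?_, fun A hA hinj => ?_⟩
  · have hRm : Measurable fun x => (lapDecimation p).eval x :=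
      (lapDecimation p).continuous.measurable
    refine ⟨hRm, Measure.ext fun B hB => ?_⟩
    have hpre : ∀ i, ν (S i ⁻¹' ((fun x => (lapDecimation p).eval x) ⁻¹' B)) = ν B := fun i => by
      refine measure_congr ?_
      filter_upwards [hsupp] with x hx
      change ((lapDecimation p).eval (S i x) ∈ B) = (x ∈ B)
      rw [hS.eval_apply i hx]
    rw [Measure.map_apply hRm hB, hν _ (hRm hB)]
    simp only [hpre, Finset.sum_const, Finset.card_univ, Fintype.card_fin, nsmul_eq_mul]
    rw [← mul_assoc]
    push_cast
    rw [ENNReal.inv_mul_cancel (by norm_num) (by norm_num), one_mul]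
  · rw [measure_image_eq_of_stationary hS (fun i => (hSc i).measurable) hsupp hν hA hinj, hdeg]
    norm_num

/-! ### The spectrum of the Laplacian -/

theorem norm_one_sub_laplacian_le {p : ℝ} (hp : p ∈ Set.Ioo (0 : ℝ) 1) :
    ‖1 - laplacian p hp‖ ≤ 1 := by
  refine ContinuousLinearMap.opNorm_le_bound _ zero_le_one fun f => ?_
  rw [one_mul]
  have h : ((1 - laplacian p hp) f : ℕ → ℂ) = (f : ℕ → ℂ) - lapFun p f := by
    funext x
    have h1 := (ae_revMeasure_iff hp).1 (Lp.coeFn_sub f (laplacian p hp f)) x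
    rw [Pi.sub_apply, laplacian_apply] at h1
    exact h1
  rw [Lp.norm_def, Lp.norm_def, h]
  exact ENNReal.toReal_mono (Lp.eLpNorm_ne_top f) (eLpNorm_sub_lapFun_le hp f)

theorem lapSpectrum_subset_Icc {p : ℝ} (hp : p ∈ Set.Ioo (0 : ℝ) 1) :
    lapSpectrum p hp ⊆ Set.Icc 0 2 := by
  intro x hx
  have h1 : (1 - x : ℂ) ∈ spectrum ℂ (1 - laplacian p hp) := by
    have h := spectrum.singleton_sub_eq (laplacian p hp) (1 : ℂ)
    rw [map_one] at h
    rw [← h]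
    exact Set.sub_mem_sub rfl hx
  have h2 := spectrum.norm_le_norm_mul_of_mem h1
  have h3 : ‖(1 : Ell2 p →L[ℂ] Ell2 p)‖ ≤ 1 := ContinuousLinearMap.norm_id_le
  have h4 : ‖(1 - x : ℂ)‖ ≤ 1 :=
    h2.trans (mul_le_one₀ (norm_one_sub_laplacian_le hp) (norm_nonneg _) h3)
  have h5 : (1 - x : ℂ) = ((1 - x : ℝ) : ℂ) := by push_cast; rfl
  rw [h5, Complex.norm_real, Real.norm_eq_abs, abs_le] at h4
  exact ⟨by linarith, by linarith⟩

theorem isClosed_lapSpectrum {p : ℝ} (hp : p ∈ Set.Ioo (0 : ℝ) 1) :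
    IsClosed (lapSpectrum p hp) :=
  (spectrum.isClosed (𝕜 := ℂ) (laplacian p hp)).preimage Complex.continuous_ofReal

/-! ### The density of states on the images of the branches -/

/-- A balanced measure of a polynomial of degree at least two has no atoms: `R` multiplies the mass
of every point by the degree. -/
theorem IsBalancedMeasure.nullSingletonClass {R : ℝ[X]} (hR : 1 < R.natDegree) {ν : Measure ℝ}
    (h : IsBalancedMeasure R ν) : NullSingletonClass ν := by
  have := h.isProbabilityMeasure
  set c : ENNReal := ⨆ y : ℝ, ν {y} with hc
  have hctop : c ≠ ⊤ := ne_top_of_le_ne_top ENNReal.one_ne_top (iSup_le fun y => prob_le_one)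
  have hle : ∀ y : ℝ, (R.natDegree : ENNReal) * ν {y} ≤ c := fun y => by
    rw [← h.balanced {y} (measurableSet_singleton y) (Set.injOn_singleton _ _),
      Set.image_singleton]
    exact le_iSup (fun y : ℝ => ν {y}) (R.eval y)
  have h2 : (2 : ENNReal) * c ≤ c := by
    rw [hc, ENNReal.mul_iSup]
    refine iSup_le fun y => le_trans ?_ (hle y)
    gcongr
    exact_mod_cast hR
  have hc0 : c = 0 := by
    have h3 : c + c ≤ 0 + c := by rwa [← two_mul, zero_add]
    exact nonpos_iff_eq_zero.1 ((ENNReal.add_le_add_iff_right hctop).1 h3)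
  exact ⟨fun y => nonpos_iff_eq_zero.1 ((le_iSup (fun y : ℝ => ν {y}) y).trans hc0.le)⟩

/-- Only the branch `S j` contributes to the density of states of `S j '' E`, since two different
branches meet over finitely many points only. A set `E` which need not be measurable is compared
with a measurable set `T ⊇ E` of the same measure. -/
theorem densityOfStates_image {p : ℝ} (hp : p ∈ Set.Ioo (0 : ℝ) 1) {R : ℝ[X]} {N : ℕ}
    {S : Fin N → ℝ → ℝ} (hS : IsInverseBranches R S) {ν : Measure ℝ} [NullSingletonClass ν]
    (j : Fin N) {E : Set ℝ} (hE : E ⊆ lapSpectrum p hp) :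
    densityOfStates p hp S ν (S j '' E) = (N : ENNReal)⁻¹ * ν E := by
  have hσ := (isClosed_lapSpectrum hp).measurableSet
  have hσI := lapSpectrum_subset_Icc hp
  set σ := lapSpectrum p hp with hσdef
  have hSm : ∀ i, AEMeasurable (S i) (ν.restrict σ) := fun i =>
    ((hS.1 i).mono hσI).aemeasurable hσ
  obtain ⟨T, hET, hTσ, hT, hTE⟩ : ∃ T, E ⊆ T ∧ T ⊆ σ ∧ MeasurableSet T ∧ ν T = ν E := by
    refine ⟨toMeasurable ν E ∩ σ, Set.subset_inter (subset_toMeasurable _ _) hE,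
      Set.inter_subset_right, (measurableSet_toMeasurable _ _).inter hσ, le_antisymm ?_ ?_⟩
    · exact (measure_mono Set.inter_subset_left).trans (measure_toMeasurable _).le
    · exact measure_mono (Set.subset_inter (subset_toMeasurable _ _) hE)
  have hinj : Set.InjOn (S j) T := fun x hx y hy hxy => by
    rw [← hS.eval_apply j (hσI (hTσ hx)), hxy, hS.eval_apply j (hσI (hTσ hy))]
  have hTm : MeasurableSet (S j '' T) :=
    hT.image_of_continuousOn_injOn ((hS.1 j).mono (hTσ.trans hσI)) hinj
  have hmeet : ∀ i, ∀ x ∈ S i ⁻¹' (S j '' T) ∩ σ, x ∈ T ∧ S i x = S j x := by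
    rintro i x ⟨⟨y, hy, hxy⟩, hx⟩
    have h1 := hS.eval_apply i (hσI hx)
    rw [← hxy, hS.eval_apply j (hσI (hTσ hy))] at h1
    subst h1
    exact ⟨hy, hxy.symm⟩
  have hupper : ∀ i, (ν.restrict σ).map (S i) (S j '' E) ≤ ν (S i ⁻¹' (S j '' T) ∩ σ) := fun i => by
    refine (measure_mono (Set.image_mono hET)).trans_eq ?_
    rw [Measure.map_apply_of_aemeasurable (hSm i) hTm, Measure.restrict_apply' hσ]
  have hother : ∀ i, i ≠ j → (ν.restrict σ).map (S i) (S j '' E) = 0 := by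
    intro i hij
    refine nonpos_iff_eq_zero.1 ((hupper i).trans ?_)
    rw [← (hS.finite_setOf_eq hij).measure_zero ν]
    exact measure_mono fun x hx => ⟨hσI hx.2, (hmeet i x hx).2⟩
  have hself : (ν.restrict σ).map (S j) (S j '' E) = ν E := by
    refine le_antisymm ((hupper j).trans ?_) ?_
    · rw [← hTE]
      exact measure_mono fun x hx => (hmeet j x hx).1
    · calc ν E = ν.restrict σ E := (Measure.restrict_eq_self ν hE).symm
        _ ≤ ν.restrict σ (S j ⁻¹' (S j '' E)) := measure_mono (Set.subset_preimage_image _ _)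
        _ ≤ _ := Measure.le_map_apply (hSm j) _
  rw [densityOfStates, Measure.smul_apply, Measure.finsetSum_apply, smul_eq_mul,
    Finset.sum_eq_single j (fun i _ hij => hother i hij) (by simp), hself]

end SelfSimilarAMO

theorem corollary4p4 (p β : ℝ) (hp : p ∈ Set.Ioo (0 : ℝ) 1) (n k : ℕ) (hn : 1 ≤ n)
    (hk : k < 3 ^ n) :
    (∃ R : Polynomial ℝ, SelfSimilarAMO.IsSpectralDecimation p β n k R ∧ R.natDegree = 3 ^ n ∧
      ∃ S : Fin (3 ^ n) → ℝ → ℝ, SelfSimilarAMO.IsInverseBranches R S) ∧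
    (∃ νp : MeasureTheory.Measure ℝ,
      SelfSimilarAMO.IsBalancedMeasure (SelfSimilarAMO.lapDecimation p) νp) ∧
    ∀ (R : Polynomial ℝ) (S : Fin (3 ^ n) → ℝ → ℝ) (νp : MeasureTheory.Measure ℝ),
      SelfSimilarAMO.IsSpectralDecimation p β n k R →
      SelfSimilarAMO.IsInverseBranches R S →
      SelfSimilarAMO.IsBalancedMeasure (SelfSimilarAMO.lapDecimation p) νp →
      ∀ (j : Fin (3 ^ n)) (E : Set ℝ), E ⊆ SelfSimilarAMO.lapSpectrum p hp →
        SelfSimilarAMO.densityOfStates p hp S νp (S j '' E) = (3 ^ n : ENNReal)⁻¹ * νp E := by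
  refine ⟨⟨SelfSimilarAMO.amoDecimation p β n k,
    SelfSimilarAMO.amoDecimation_isSpectralDecimation hp β n k,
    SelfSimilarAMO.amoDecimation_natDegree hp β n k,
    SelfSimilarAMO.amoDecimation_exists_isInverseBranches hp β n k⟩,
    SelfSimilarAMO.exists_isBalancedMeasure hp, fun R S νp _ hS hν j E hE => ?_⟩
  have := hν.nullSingletonClass (by rw [SelfSimilarAMO.lapDecimation_natDegree hp]; norm_num)
  rw [SelfSimilarAMO.densityOfStates_image hp hS j hE]
  push_cast
  rfl
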